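/- All alphabets $\mathcal X,\mathcal Y_k,\mathcal S,\mathcal U,\mathcal V_k,\mathcal Z,\mathcal T$ ($k=1,\dots,K$) are finite, logarithms are base 2, and the reproduction alphabets $\hat{\mathcal X}_k$ are arbitrary sets. Let $(X_i,Y_{1,i},\dots,Y_{K,i})$, $i\ge 1$, be i.i.d. copies of $(X,Y_1,\dots,Y_K)$, let $p_{V_1\cdots V_K|US}$ be a memoryless broadcast channel with input $u$ and state $s$, let $p_S$ be a fixed distribution on $\mathcal S$, let $d_k:\mathcal X\times\hat{\mathcal X}_k\to[0,\infty)$ be distortion measures, extended to words by $d_k(x^n,\hat x^n)=\frac1n\sum_{j=1}^n d_k(x_j,\hat x_j)$, and let $\kappa>0$ be rational. A code with parameters $(m,n)$ consists of an encoder $\phi:\mathcal X^n\times\mathcal S^m\to\mathcal U^m$, which knows the whole state word non-causally, and decoders $\psi_k:\mathcal V_k^m\times\mathcal Y_k^n\to\hat{\mathcal X}_k^n$. The state word $S^m$ has, for each $(m,n)$, some law, which may depend on the source word $X^n$ but is such that $S^m$ and $(Y_1^n,\dots,Y_K^n)$ are conditionally independent given $X^n$. For $\eta>0$ let $\mathcal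 T_\eta^m(S)$ be the set of $s^m\in\mathcal S^m$ with $|N(a|s^m)/m-p_S(a)|\le\eta\,p_S(a)$ for all $a\in\mathcal S$, where $N(a|s^m)$ is the number of occurrences of $a$ in $s^m$; call the state $\eta$-typical if $\Pr[S^m\in\mathcal T_\eta^m(S)]\to1$ as $n\to\infty$ with $m/n=\kappa$ (for example, if always $S^m\in\mathcal T^m_\eta(S)$ for large $n$, or if $S^m$ is i.i.d. with law $p_S$). For a given state, $(D_1,\dots,D_K)$ is achievable at rate $\kappa$ if for every $\epsilon>0$ there is $n_0$ such that for all integers $m>0$, $n>n_0$ with $m/n=\kappa$ there is a code with $\mathrm E[d_k(X^n,\hat X_k^n)]\le D_k+\epsilon$ for all $k$, where $\hat X_k^n=\psi_k(V_k^m,Y_k^n)$ and $V_k^m$ is the output at receiver $k$ of the channel with input word $\phi(X^n,S^m)$ and state word $S^m$. Theorem. Suppose that there are random variables $Z\in\mathcal Z$, $T\in\mathcal T$, $U\in\mathcal U$ and functions $g_k:\mathcal Z\times\mathcal Y_k\to\hat{\mathcal X}_k$ with Markov chains $(Y_1,\dots,Y_K)-X-Z$ and $T-(U,S)-(V_1,\dots,V_K)$,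 where $S\sim p_S$ and $(V_1,\dots,V_K)$ given $(U,S)$ has the law $p_{V_1\cdots V_K|US}$, such that for every $k=1,\dots,K$ $$I(X;Z|Y_k)<\kappa\,[I(T;V_k)-I(T;S)],\qquad \mathrm E[d_k(X,g_k(Z,Y_k))]\le D_k.$$ Then there is $\eta>0$ such that, for every $\eta$-typical state, $(D_1,\dots,D_K)$ is achievable at rate $\kappa$. -/

import Mathlib

open scoped NNReal

namespace WZBC

noncomputable section

/-! ## Discrete random variables: laws, Markov chains, mutual information (in bits) -/

/-- `Pr[A = a]` for a random variable `A` on a discrete probability space. -/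
def prob {Ω α : Type*} (P : PMF Ω) (A : Ω → α) (a : α) : ℝ :=
  (P.map A a).toReal

/-- The Markov chain `A - B - C`: `A` and `C` are conditionally independent given `B`. -/
def IsMarkovChain {Ω α β γ : Type*} (P : PMF Ω) (A : Ω → α) (B : Ω → β) (C : Ω → γ) : Prop :=
  ∀ a b c,
    prob P (fun ω => (A ω, B ω, C ω)) (a, b, c) * prob P B b =
      prob P (fun ω => (A ω, B ω)) (a, b) * prob P (fun ω => (B ω, C ω)) (b, c)

/-- The mutual information `I(A;B)`, in bits. -/
def mutualInfo {Ω α β : Type*} [Fintype α] [Fintype β]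
    (P : PMF Ω) (A : Ω → α) (B : Ω → β) : ℝ :=
  ∑ a, ∑ b, prob P (fun ω => (A ω, B ω)) (a, b) *
    Real.logb 2 (prob P (fun ω => (A ω, B ω)) (a, b) / (prob P A a * prob P B b))

/-- The conditional mutual information `I(A;B|C)`, in bits. -/
def condMutualInfo {Ω α β γ : Type*} [Fintype α] [Fintype β] [Fintype γ]
    (P : PMF Ω) (A : Ω → α) (B : Ω → β) (C : Ω → γ) : ℝ :=
  ∑ a, ∑ b, ∑ c, prob P (fun ω => (A ω, B ω, C ω)) (a, b, c) *
    Real.logb 2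
      ((prob P (fun ω => (A ω, B ω, C ω)) (a, b, c) * prob P C c) /
        (prob P (fun ω => (A ω, C ω)) (a, c) * prob P (fun ω => (B ω, C ω)) (b, c)))

open Classical in
/-- The number `N(a|s)` of occurrences of the letter `a` in the word `s`. -/
def occurrences {𝒮 : Type*} {m : ℕ} (s : Fin m → 𝒮) (a : 𝒮) : ℕ :=
  (Finset.univ.filter fun j => s j = a).card

/-- The (robustly) typical set `T_η^m(p)`: words `s` of length `m` such that
`|N(a|s)/m - p(a)| ≤ η p(a)` for every letter `a`. -/
def typicalSet {𝒮 : Type*} (η : ℝ) (m : ℕ) (p : PMF 𝒮) : Set (Fin m → 𝒮) :=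
  {s | ∀ a, |(occurrences s a : ℝ) / m - (p a).toReal| ≤ η * (p a).toReal}

/-! ## Coding over a broadcast channel with state known non-causally at the encoder -/

/-- A code for `n` source symbols and `m` channel uses. The encoder sees the whole source word and
the whole state word; decoder `k` sees its channel output and its side information. -/
structure Code {K : ℕ} (m n : ℕ) (𝒳 𝒮 𝒰 : Type*) (𝒱 𝒴 𝒳hat : Fin K → Type*) where
  /-- the encoder -/
  enc : (Fin n → 𝒳) → (Fin m → 𝒮) → (Fin m → 𝒰)
  /-- the decoders -/
  dec : ∀ k, (Fin m → 𝒱 k) → (Fin n → 𝒴 k) → (Fin n → 𝒳hat k)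

/-- A model of the state words: for block lengths `n` (source) and `m` (channel), the conditional
law of the state word `S^m` given the source word `X^n`. A state independent of the source is the
case in which this law does not depend on the source word. -/
abbrev StateModel (𝒳 𝒮 : Type*) := ∀ n m : ℕ, (Fin n → 𝒳) → PMF (Fin m → 𝒮)

/-- The distortion `d(x^n, x̂^n) = (1/n) ∑ d(x_j, x̂_j)` between words. -/
def blockDistortion {𝒳 𝒳h : Type*} {n : ℕ} (d : 𝒳 → 𝒳h → ℝ≥0)
    (x : Fin n → 𝒳) (xh : Fin n → 𝒳h) : ℝ :=
  (1 / (n : ℝ)) * ∑ j, (d (x j) (xh j) : ℝ)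

section Problem

variable {K : ℕ} {𝒳 𝒮 𝒰 : Type*} {𝒱 𝒴 𝒳hat : Fin K → Type*}
  [Fintype 𝒳] [Fintype 𝒮] [∀ k, Fintype (𝒱 k)] [∀ k, Fintype (𝒴 k)]

/-- The expected distortion of a code at receiver `k`. The pairs `(X_i, (Y_{1,i}, …, Y_{K,i}))` are
i.i.d. with law `pXY`; the state word has conditional law `Q n m x` given `X^n = x` (and given
`X^n` it is independent of the side information); the channel `W` is memoryless: given the input
word and the state word, its outputs are independent over time with laws `W (u_j) (s_j)`. -/
def expectedDistortion (pXY : PMF (𝒳 × (∀ k, 𝒴 k))) (W : 𝒰 → 𝒮 → PMF (∀ k, 𝒱 k))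
    (Q : StateModel 𝒳 𝒮) {m n : ℕ} (C : Code m n 𝒳 𝒮 𝒰 𝒱 𝒴 𝒳hat) (k : Fin K)
    (d : 𝒳 → 𝒳hat k → ℝ≥0) : ℝ :=
  ∑ x : Fin n → 𝒳, ∑ y : Fin n → (∀ k, 𝒴 k), ∑ s : Fin m → 𝒮, ∑ v : Fin m → (∀ k, 𝒱 k),
    (∏ i, (pXY (x i, y i)).toReal) * (Q n m x s).toReal *
      (∏ j, (W (C.enc x s j) (s j) (v j)).toReal) *
      blockDistortion d x (C.dec k (fun j => v j k) (fun i => y i k))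

/-- The state word `S^m` lies in `T_η^m(pS)` with probability tending to one, along block lengths
with `m / n = κ`. This holds in particular if `S^m` always lies in `T_η^m(pS)` at all large block
lengths, and if `S^m` is i.i.d. with law `pS`. -/
def StateTypical (pXY : PMF (𝒳 × (∀ k, 𝒴 k))) (pS : PMF 𝒮) (Q : StateModel 𝒳 𝒮)
    (κ : ℚ) (η : ℝ) : Prop :=
  ∀ ε : ℝ, 0 < ε → ∃ n₀ : ℕ, ∀ m n : ℕ, 0 < m → n₀ < n → (m : ℚ) / (n : ℚ) = κ →
    1 - ε ≤ ∑ x : Fin n → 𝒳, ∑ s : Fin m → 𝒮,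
      (∏ i, (pXY.map Prod.fst (x i)).toReal) *
        (typicalSet η m pS).indicator (fun s => (Q n m x s).toReal) s

/-- The distortion tuple `D` is achievable at rate `κ` channel uses per source symbol. -/
def Achievable (pXY : PMF (𝒳 × (∀ k, 𝒴 k))) (W : 𝒰 → 𝒮 → PMF (∀ k, 𝒱 k))
    (Q : StateModel 𝒳 𝒮) (d : ∀ k, 𝒳 → 𝒳hat k → ℝ≥0) (κ : ℚ) (D : Fin K → ℝ) : Prop :=
  ∀ ε : ℝ, 0 < ε → ∃ n₀ : ℕ, ∀ m n : ℕ, 0 < m → n₀ < n → (m : ℚ) / (n : ℚ) = κ →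
    ∃ C : Code m n 𝒳 𝒮 𝒰 𝒱 𝒴 𝒳hat,
      ∀ k, expectedDistortion pXY W Q C k (d k) ≤ D k + ε

end Problem

end

end WZBC

namespace WZBC

/-! Source and channel are coded jointly, without quantisation or binning indices. The codeword is a
pair `c = (z, t)` of words over `𝒵` (length `n`) and `𝒯` (length `m`). The encoder gives it the
weight `P c = Pr[z|x] Pr[t|s]` and receiver `k` the weight `R c = Pr[z|y_k] Pr[t|v_k]`, both
products over letters. All terminals select by one common rule: independent unit exponential clocks,
one per `c`, are run at rates given by the weights, and the first to ring wins. The races with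
weights `P` and `R` are both won by `c` with probability at least `P c * R c / (P c + R c)`
(`le_clockMeasure_winsRace_inter`), nearly `P c` when `P c` is much smaller than `R c`. Fixing good
clocks, and then the best channel input for each pair of source and state words, leaves one
deterministic code for all receivers (`exists_oneShot_code`).

It remains to see that `P c / R c` is small with high probability. Under the single-letter laws, the
logarithm of this ratio per source letter has mean `I(X;Z|Y_k) - κ (I(T;V_k) - I(T;S))` up to the
factor `log 2`, which is negative by hypothesis. For `0 ≤ l ≤ 1` the mass lost to mismatches is at
most the moment of `(P c / R c) ^ l`, which factors over letters. Its exponent vanishes at `l = 0`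
and has the mean above as derivative there, so it is negative for some small `l`
(`exists_rate_exponent`). Each state letter contributes one factor, so only letter frequencies
matter: typicality perturbs the exponent by at most `η` times a constant, and a small `η` keeps it
negative. The bound holds for every typical state word separately, which is why the state may depend
on the source.

Excess distortion is controlled by the same Chernoff argument (`exists_distortion_exponent`). The
exceptional event adds little to the mean distortion, because finitely many distortion values occur.
-/

/-! ### Exponential clocks and races -/

open MeasureTheory ProbabilityTheory in
theorem expMeasure_one_Ioi {y : ℝ} (hy : 0 ≤ y) :
    expMeasure 1 (Set.Ioi y) = ENNReal.ofReal (Real.exp (-y)) := by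
  have : IsProbabilityMeasure (expMeasure 1) := isProbabilityMeasure_expMeasure one_pos
  have h := cdf_expMeasure_eq one_pos y
  rw [cdf_eq_real, if_pos hy, one_mul] at h
  have h2 : (expMeasure 1).real (Set.Ioi y) = Real.exp (-y) := by
    rw [← Set.compl_Iic, probReal_compl_eq_one_sub measurableSet_Iic, h]; ring
  rw [← h2, ofReal_measureReal]

open MeasureTheory ProbabilityTheory in
theorem ae_pos_expMeasure_one : ∀ᵐ y ∂(expMeasure 1), 0 < y := by
  have : IsProbabilityMeasure (expMeasure 1) := isProbabilityMeasure_expMeasure one_pos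
  have h := expMeasure_one_Ioi le_rfl
  rw [neg_zero, Real.exp_zero, ENNReal.ofReal_one] at h
  exact (prob_compl_eq_zero_iff measurableSet_Ioi).2 h

-- Tilting the unit exponential density by `exp (-(R * x))` gives `1 / (1 + R)` times the density of
-- rate `1 + R`.
open MeasureTheory ProbabilityTheory in
theorem lintegral_exp_neg_mul_expMeasure {R : ℝ} (hR : 0 ≤ R) :
    ∫⁻ x, ENNReal.ofReal (Real.exp (-(R * x))) ∂(expMeasure 1) = ENNReal.ofReal (1 / (1 + R)) := by
  have h1 : (0 : ℝ) < 1 + R := by linarith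
  have hd : expMeasure 1 = volume.withDensity (exponentialPDF 1) := rfl
  have hm : ∀ r, Measurable (exponentialPDF r) := fun r =>
    (measurable_exponentialPDFReal r).ennreal_ofReal
  rw [hd, lintegral_withDensity_eq_lintegral_mul _ (hm 1) (by fun_prop)]
  have : ∀ x, (exponentialPDF 1 * fun x => ENNReal.ofReal (Real.exp (-(R * x)))) x =
      ENNReal.ofReal (1 / (1 + R)) * exponentialPDF (1 + R) x := by
    intro x
    simp only [Pi.mul_apply, exponentialPDF_eq]
    split_ifs with hx
    · rw [← ENNReal.ofReal_mul (by positivity), ← ENNReal.ofReal_mul (by positivity), one_mul,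
        ← Real.exp_add, ← mul_assoc, one_div, inv_mul_cancel₀ h1.ne', one_mul]
      congr 2; ring_nf
    · simp
  simp_rw [this]
  rw [lintegral_const_mul _ (hm _), lintegral_exponentialPDF_eq_one h1, mul_one]

/-- The product law of independent unit-rate exponential clocks. -/
noncomputable def clockMeasure (C : Type*) [Fintype C] : MeasureTheory.Measure (C → ℝ) :=
  MeasureTheory.Measure.pi fun _ => ProbabilityTheory.expMeasure 1

instance (C : Type*) [Fintype C] : MeasureTheory.IsProbabilityMeasure (clockMeasure C) := by
  have : MeasureTheory.IsProbabilityMeasure (ProbabilityTheory.expMeasure 1) :=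
    ProbabilityTheory.isProbabilityMeasure_expMeasure one_pos
  unfold clockMeasure; infer_instance

-- Given `ω c₀`, the other clocks are independent and exceed their thresholds with probability `exp
-- (-(∑ r c) * ω c₀)`; integrating over `ω c₀` is a Laplace transform.
open MeasureTheory ProbabilityTheory in
theorem clockMeasure_first {C : Type*} [Fintype C] [DecidableEq C] (c₀ : C) (r : C → ℝ)
    (hr : ∀ c, 0 ≤ r c) :
    ENNReal.ofReal (1 / (1 + ∑ c ∈ Finset.univ.erase c₀, r c)) ≤
      clockMeasure C {ω | ∀ c, c ≠ c₀ → r c * ω c₀ < ω c} := by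
  have : IsProbabilityMeasure (expMeasure 1) := isProbabilityMeasure_expMeasure one_pos
  have hmeas : MeasurableSet {ω : C → ℝ | ∀ c, c ≠ c₀ → r c * ω c₀ < ω c} := by
    simp only [Set.ofPred_forall]
    refine MeasurableSet.iInter fun c => MeasurableSet.iInter fun _ => ?_
    exact measurableSet_lt (by fun_prop) (by fun_prop)
  obtain ⟨p, hp⟩ : ∃ p : C → Prop, ∀ c, p c ↔ c = c₀ := ⟨_, fun _ => Iff.rfl⟩
  have : DecidablePred p := fun c => decidable_of_iff _ (hp c).symm
  have hp₀ : p c₀ := (hp c₀).2 rfl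
  have hmp := (measurePreserving_piEquivPiSubtypeProd (fun _ : C => expMeasure 1)
    p)
  set e := MeasurableEquiv.piEquivPiSubtypeProd (fun _ : C => ℝ) p with he
  have h1 := hmp.symm.measure_preimage hmeas.nullMeasurableSet
  rw [clockMeasure, ← h1, Measure.prod_apply (e.symm.measurable hmeas)]
  have hpos : ∀ᵐ x : {c // p c} → ℝ ∂(Measure.pi fun _ => expMeasure 1),
      0 < x ⟨c₀, hp₀⟩ := by
    have hmp2 := measurePreserving_eval (μ := fun _ : {c // p c} => expMeasure 1) ⟨c₀, hp₀⟩
    exact hmp2.quasiMeasurePreserving.ae ae_pos_expMeasure_one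
  have hmp2 := measurePreserving_eval (μ := fun _ : {c // p c} => expMeasure 1) ⟨c₀, hp₀⟩
  have hR : 0 ≤ ∑ c ∈ Finset.univ.erase c₀, r c := Finset.sum_nonneg fun c _ => hr c
  rw [← lintegral_exp_neg_mul_expMeasure hR, ← hmp2.lintegral_comp (by fun_prop)]
  refine lintegral_mono_ae ?_
  filter_upwards [hpos] with x hx
  have hset : Prod.mk x ⁻¹' (e.symm ⁻¹' {ω : C → ℝ | ∀ c, c ≠ c₀ → r c * ω c₀ < ω c}) =
      Set.univ.pi fun c : {c // ¬ p c} => Set.Ioi (r c * x ⟨c₀, hp₀⟩) := by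
    ext y
    simp only [Set.mem_preimage, Set.mem_ofPred_eq, Set.mem_pi, Set.mem_univ, forall_true_left,
      Set.mem_Ioi, Subtype.forall]
    refine forall_congr' fun c => ?_
    rw [ne_eq, ← hp c]
    refine forall_congr' fun hc => ?_
    simp [he, MeasurableEquiv.piEquivPiSubtypeProd, Equiv.piEquivPiSubtypeProd, hc, hp₀]
  rw [hset, Measure.pi_pi]
  simp_rw [expMeasure_one_Ioi (mul_nonneg (hr _) hx.le)]
  rw [← ENNReal.ofReal_prod_of_nonneg (fun _ _ => (Real.exp_pos _).le), ← Real.exp_sum]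
  apply le_of_eq
  congr 2
  rw [Finset.sum_neg_distrib, ← Finset.sum_mul]
  congr 2
  rw [← Finset.sum_subtype (Finset.univ.erase c₀) (p := fun c => ¬ p c) (by simp [hp]) r]

/-- `c` wins the race of the clocks `ω` run at the rates `P`. -/
def WinsRace {C : Type*} (ω P : C → ℝ) (c : C) : Prop := ∀ c', c' ≠ c → P c' * ω c < P c * ω c'

theorem WinsRace.unique {C : Type*} {ω P : C → ℝ} {c c' : C} (h : WinsRace ω P c)
    (h' : WinsRace ω P c') : c = c' := by
  by_contra hne
  exact lt_asymm (h c' (Ne.symm hne)) (h' c hne)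

theorem measurableSet_winsRace {C : Type*} [Fintype C] (P : C → ℝ) (c : C) :
    MeasurableSet {ω : C → ℝ | WinsRace ω P c} := by
  simp only [WinsRace, Set.ofPred_forall]
  refine MeasurableSet.iInter fun c => MeasurableSet.iInter fun _ => ?_
  exact measurableSet_lt (by fun_prop) (by fun_prop)

-- Winning both races is one race in which rival `c` has relative rate `max (P c / P c₀) (Q c / Q
-- c₀)`. Bounding the maximum by the sum, the winning probability is at least `1 / (1 / P c₀ + 1 / Q
-- c₀ - 1)`, slightly more than is claimed.
open MeasureTheory in
theorem le_clockMeasure_winsRace_inter {C : Type*} [Fintype C] {P Q : C → ℝ}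
    (hP : ∀ c, 0 ≤ P c) (hQ : ∀ c, 0 ≤ Q c) (hP1 : ∑ c, P c ≤ 1) (hQ1 : ∑ c, Q c ≤ 1) (c₀ : C) :
    P c₀ * Q c₀ / (P c₀ + Q c₀) ≤
      (clockMeasure C).real ({ω | WinsRace ω P c₀} ∩ {ω | WinsRace ω Q c₀}) := by
  classical
  rcases (hP c₀).eq_or_lt with h0 | hP0
  · simp [← h0]
  rcases (hQ c₀).eq_or_lt with h0 | hQ0
  · simp [← h0]
  have hpos : ∀ᵐ ω ∂(clockMeasure C), 0 < ω c₀ := by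
    have : IsProbabilityMeasure (ProbabilityTheory.expMeasure 1) :=
      ProbabilityTheory.isProbabilityMeasure_expMeasure one_pos
    have hmp2 := measurePreserving_eval (μ := fun _ : C => ProbabilityTheory.expMeasure 1) c₀
    exact hmp2.quasiMeasurePreserving.ae ae_pos_expMeasure_one
  set r : C → ℝ := fun c => max (P c / P c₀) (Q c / Q c₀) with hr
  have hr0 : ∀ c, 0 ≤ r c := fun c => le_max_of_le_left (div_nonneg (hP c) hP0.le)
  have h1 := clockMeasure_first c₀ r hr0
  have h2 : clockMeasure C {ω | ∀ c, c ≠ c₀ → r c * ω c₀ < ω c} ≤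
      clockMeasure C ({ω | WinsRace ω P c₀} ∩ {ω | WinsRace ω Q c₀}) := by
    refine measure_mono_ae ?_
    filter_upwards [hpos] with ω hω h
    refine ⟨fun c hc => ?_, fun c hc => ?_⟩
    · have h3 : P c / P c₀ * ω c₀ < ω c :=
        (mul_le_mul_of_nonneg_right (le_max_left _ _) hω.le).trans_lt (h c hc)
      rwa [div_mul_eq_mul_div, div_lt_iff₀ hP0, mul_comm (ω c)] at h3
    · have h3 : Q c / Q c₀ * ω c₀ < ω c :=
        (mul_le_mul_of_nonneg_right (le_max_right _ _) hω.le).trans_lt (h c hc)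
      rwa [div_mul_eq_mul_div, div_lt_iff₀ hQ0, mul_comm (ω c)] at h3
  have h3 := h1.trans h2
  rw [ENNReal.ofReal_le_iff_le_toReal (measure_ne_top _ _)] at h3
  refine le_trans ?_ h3
  have hS : ∑ c ∈ Finset.univ.erase c₀, r c ≤
      (1 - P c₀) / P c₀ + (1 - Q c₀) / Q c₀ := by
    calc ∑ c ∈ Finset.univ.erase c₀, r c
        ≤ ∑ c ∈ Finset.univ.erase c₀, (P c / P c₀ + Q c / Q c₀) :=
          Finset.sum_le_sum fun c _ => max_le_add_of_nonneg (div_nonneg (hP c) hP0.le)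
            (div_nonneg (hQ c) hQ0.le)
      _ = (∑ c ∈ Finset.univ.erase c₀, P c) / P c₀ + (∑ c ∈ Finset.univ.erase c₀, Q c) / Q c₀ := by
          rw [Finset.sum_add_distrib, Finset.sum_div, Finset.sum_div]
      _ ≤ _ := by
          have e1 := Finset.add_sum_erase Finset.univ P (Finset.mem_univ c₀)
          have e2 := Finset.add_sum_erase Finset.univ Q (Finset.mem_univ c₀)
          gcongr <;> linarith
  have hS0 : 0 ≤ ∑ c ∈ Finset.univ.erase c₀, r c := Finset.sum_nonneg fun c _ => hr0 c
  rw [div_le_div_iff₀ (by positivity) (by positivity)]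
  have h5 : P c₀ * Q c₀ * (1 + ((1 - P c₀) / P c₀ + (1 - Q c₀) / Q c₀)) =
      P c₀ + Q c₀ - P c₀ * Q c₀ := by field_simp; ring_nf
  have h6 := mul_le_mul_of_nonneg_left hS (mul_pos hP0 hQ0).le
  have h7 := mul_pos hP0 hQ0
  nlinarith

/-! ### Common selection rule and one-shot coding -/

open Classical MeasureTheory in
/-- A common selection rule: a deterministic map from weight vectors to elements such that the
selections made from `P i` and `Q i` simultaneously hit `c i` about as often as a single selection
from `P i` would, unless `Q i (c i)` is much smaller than `P i (c i)`. -/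
theorem exists_pick {C I : Type*} [Fintype C] [Nonempty C] [Fintype I] (w : I → ℝ)
    (hw : ∀ i, 0 ≤ w i) (P Q : I → C → ℝ) (hP : ∀ i c, 0 ≤ P i c) (hQ : ∀ i c, 0 ≤ Q i c)
    (hP1 : ∀ i, ∑ c, P i c ≤ 1) (hQ1 : ∀ i, ∑ c, Q i c ≤ 1) (c : I → C) :
    ∃ pick : (C → ℝ) → C,
      ∑ i, w i * (P i (c i) * Q i (c i) / (P i (c i) + Q i (c i))) ≤
        ∑ i, w i * (if pick (P i) = c i ∧ pick (Q i) = c i then 1 else 0) := by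
  let E : I → Set (C → ℝ) := fun i => {ω | WinsRace ω (P i) (c i)} ∩ {ω | WinsRace ω (Q i) (c i)}
  have hE : ∀ i, MeasurableSet (E i) := fun i =>
    (measurableSet_winsRace _ _).inter (measurableSet_winsRace _ _)
  have hint : ∀ i ∈ Finset.univ, Integrable (fun ω => w i * (E i).indicator (fun _ => (1 : ℝ)) ω)
      (clockMeasure C) := fun i _ => ((integrable_const _).indicator (hE i)).const_mul _
  -- Probabilistic method: some clock configuration does at least as well as the mean of the whole
  -- weighted sum.
  obtain ⟨ω, hω⟩ := exists_integral_le (integrable_finsetSum _ hint)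
  rw [integral_finsetSum _ hint] at hω
  -- With ties or zero weights a race may have no winner; the default value is harmless, since only
  -- configurations with a winner are counted.
  refine ⟨fun R => if h : ∃ c, WinsRace ω R c then h.choose else Classical.arbitrary C, ?_⟩
  have hpick : ∀ R c, WinsRace ω R c →
      (if h : ∃ c, WinsRace ω R c then h.choose else Classical.arbitrary C) = c := by
    intro R c h
    have h' : ∃ c, WinsRace ω R c := ⟨c, h⟩
    rw [dif_pos h']
    exact h'.choose_spec.unique h
  calc _ ≤ ∑ i, ∫ ω, w i * (E i).indicator (fun _ => (1 : ℝ)) ω ∂(clockMeasure C) := by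
        refine Finset.sum_le_sum fun i _ => ?_
        rw [integral_const_mul, integral_indicator_const _ (hE i), smul_eq_mul, mul_one]
        exact mul_le_mul_of_nonneg_left
          (le_clockMeasure_winsRace_inter (hP i) (hQ i) (hP1 i) (hQ1 i) (c i)) (hw i)
    _ ≤ _ := hω
    _ ≤ _ := by
        refine Finset.sum_le_sum fun i _ => mul_le_mul_of_nonneg_left ?_ (hw i)
        by_cases h : ω ∈ E i
        · rw [Set.indicator_of_mem h, if_pos ⟨hpick _ _ h.1, hpick _ _ h.2⟩]
        · rw [Set.indicator_of_notMem h]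
          split_ifs <;> norm_num

open Classical in
/-- The real-valued indicator of a proposition. -/
noncomputable def truthValue (p : Prop) : ℝ := if p then 1 else 0

theorem truthValue_of_true {p : Prop} (h : p) : truthValue p = 1 := if_pos h

theorem truthValue_of_not {p : Prop} (h : ¬p) : truthValue p = 0 := if_neg h

theorem truthValue_nonneg (p : Prop) : 0 ≤ truthValue p := by
  unfold truthValue; split_ifs <;> norm_num

theorem truthValue_le_one (p : Prop) : truthValue p ≤ 1 := by
  unfold truthValue; split_ifs <;> norm_num

open Classical in
/-- One-shot joint source-channel coding over a broadcast channel with state: a random pair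
`(c, u)` drawn from `P x s c * β s c u` is replaced by a deterministic encoder, and the decoders
guess `c` from the posterior weights `R k`. -/
theorem exists_oneShot_code {K : ℕ} {𝒳 𝒴 𝒮 𝒰 𝒱 𝒞 : Type*} {𝒴' 𝒱' : Fin K → Type*}
    [Fintype 𝒳] [Fintype 𝒴] [Fintype 𝒮] [Fintype 𝒰] [Nonempty 𝒰] [Fintype 𝒱] [Fintype 𝒞]
    [Nonempty 𝒞] (projY : ∀ k, 𝒴 → 𝒴' k) (projV : ∀ k, 𝒱 → 𝒱' k)
    (p : 𝒳 → 𝒴 → ℝ) (q : 𝒳 → 𝒮 → ℝ) (W : 𝒰 → 𝒮 → 𝒱 → ℝ) (P : 𝒳 → 𝒮 → 𝒞 → ℝ)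
    (β : 𝒮 → 𝒞 → 𝒰 → ℝ) (R : ∀ k, 𝒱' k → 𝒴' k → 𝒞 → ℝ) (ok : Fin K → 𝒳 → 𝒴 → 𝒞 → Prop)
    (hp : ∀ x y, 0 ≤ p x y) (hq : ∀ x s, 0 ≤ q x s) (hW : ∀ u s v, 0 ≤ W u s v)
    (hP : ∀ x s c, 0 ≤ P x s c) (hP1 : ∀ x s, ∑ c, P x s c ≤ 1)
    (hβ : ∀ s c u, 0 ≤ β s c u) (hβ1 : ∀ s c, ∑ u, β s c u ≤ 1)
    (hR : ∀ k v y c, 0 ≤ R k v y c) (hR1 : ∀ k v y, ∑ c, R k v y c ≤ 1) :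
    ∃ (enc : 𝒳 → 𝒮 → 𝒰) (dec : ∀ k, 𝒱' k → 𝒴' k → 𝒞),
      ∑ x, ∑ s, ∑ c, ∑ u, ∑ y, ∑ v, ∑ k, p x y * q x s * W u s v * β s c u *
          truthValue (ok k x y c) *
          (P x s c * R k (projV k v) (projY k y) c / (P x s c + R k (projV k v) (projY k y) c)) ≤
        ∑ x, ∑ s, ∑ y, ∑ v, ∑ k, p x y * q x s * W (enc x s) s v *
          truthValue (ok k x y (dec k (projV k v) (projY k y))) := by
  obtain ⟨pick, hpick⟩ := exists_pick (C := 𝒞) (I := 𝒳 × 𝒮 × 𝒞 × 𝒰 × 𝒴 × 𝒱 × Fin K)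
    (fun ⟨x, s, c, u, y, v, k⟩ => p x y * q x s * W u s v * β s c u *
          truthValue (ok k x y c))
    (by
      rintro ⟨x, s, c, u, y, v, k⟩
      exact mul_nonneg (mul_nonneg (mul_nonneg (mul_nonneg (hp _ _) (hq _ _)) (hW _ _ _))
        (hβ _ _ _)) (truthValue_nonneg _))
    (fun ⟨x, s, _, _, _, _, _⟩ => P x s)
    (fun ⟨_, _, _, _, y, v, k⟩ => R k (projV k v) (projY k y))
    (fun _ => hP _ _) (fun _ => hR _ _ _) (fun _ => hP1 _ _) (fun _ => hR1 _ _ _)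
    (fun ⟨_, _, c, _, _, _, _⟩ => c)
  simp only [Fintype.sum_prod_type] at hpick
  let G : 𝒳 → 𝒮 → 𝒰 → ℝ := fun x s u => ∑ y, ∑ v, ∑ k, p x y * q x s * W u s v *
    truthValue (ok k x y (pick (R k (projV k v) (projY k y))))
  have hG : ∀ x s u, 0 ≤ G x s u := fun x s u => Finset.sum_nonneg fun y _ =>
    Finset.sum_nonneg fun v _ => Finset.sum_nonneg fun k _ =>
      mul_nonneg (mul_nonneg (mul_nonneg (hp _ _) (hq _ _)) (hW _ _ _))
        (truthValue_nonneg _)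
  -- Once the selection rule is fixed, the success mass is linear in the law of `u`, so the best `u`
  -- does at least as well as one drawn from `β`.
  choose enc henc using fun x s => Finite.exists_max (G x s)
  refine ⟨enc, fun k v y => pick (R k v y), hpick.trans ?_⟩
  refine Finset.sum_le_sum fun x _ => Finset.sum_le_sum fun s _ => ?_
  calc _ ≤ ∑ c, ∑ u, (if pick (P x s) = c then 1 else 0) * (β s c u * G x s u) := by
        refine Finset.sum_le_sum fun c _ => Finset.sum_le_sum fun u _ => ?_
        simp only [G, Finset.mul_sum]
        refine Finset.sum_le_sum fun y _ => Finset.sum_le_sum fun v _ =>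
          Finset.sum_le_sum fun k _ => ?_
        have h0 : 0 ≤ p x y * q x s * W u s v * β s c u :=
          mul_nonneg (mul_nonneg (mul_nonneg (hp _ _) (hq _ _)) (hW _ _ _)) (hβ _ _ _)
        by_cases h1 : pick (P x s) = c
        · by_cases h2 : pick (R k (projV k v) (projY k y)) = c
          · rw [if_pos ⟨h1, h2⟩, if_pos h1, h2]
            apply le_of_eq; ring
          · rw [if_neg (fun h => h2 h.2), if_pos h1, mul_zero, one_mul]
            refine (mul_nonneg h0 (truthValue_nonneg
              (ok k x y (pick (R k (projV k v) (projY k y)))))).trans_eq ?_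
            ring
        · simp [h1]
    _ = ∑ u, β s (pick (P x s)) u * G x s u := by
        rw [Finset.sum_comm]
        refine Finset.sum_congr rfl fun u _ => ?_
        simp
    _ ≤ ∑ u, β s (pick (P x s)) u * G x s (enc x s) :=
        Finset.sum_le_sum fun u _ => mul_le_mul_of_nonneg_left (henc x s u) (hβ _ _ _)
    _ ≤ G x s (enc x s) := by
        rw [← Finset.sum_mul]
        exact mul_le_of_le_one_left (hG _ _ _) (hβ1 _ _)

/-! ### Finite laws, conditional probabilities and mutual information -/

section Prob

variable {Ω α β γ : Type*} (P : PMF Ω)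

theorem prob_nonneg (A : Ω → α) (a : α) : 0 ≤ prob P A a := ENNReal.toReal_nonneg

open Classical in
theorem prob_comp [Fintype α] (A : Ω → α) (f : α → β) (b : β) :
    prob P (fun ω => f (A ω)) b = ∑ a, if f a = b then prob P A a else 0 := by
  have h : P.map (fun ω => f (A ω)) = (P.map A).map f := (PMF.map_comp A P f).symm
  rw [prob, h, PMF.map_apply, tsum_fintype, ENNReal.toReal_sum]
  · refine Finset.sum_congr rfl fun a _ => ?_
    simp only [eq_comm (a := b)]
    split_ifs <;> simp [prob]
  · intro a _
    split_ifs
    · exact PMF.apply_ne_top _ _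
    · simp

theorem sum_prob [Fintype α] (A : Ω → α) : ∑ a, prob P A a = 1 := by
  have h := (P.map A).tsum_coe
  rw [tsum_fintype] at h
  rw [← ENNReal.toReal_one, ← h, ENNReal.toReal_sum fun a _ => PMF.apply_ne_top _ _]
  rfl

theorem sum_prob_comp_mul [Fintype α] [Fintype β] (A : Ω → α) (f : α → β) (h : β → ℝ) :
    ∑ b, prob P (fun ω => f (A ω)) b * h b = ∑ a, prob P A a * h (f a) := by
  classical
  simp_rw [prob_comp, Finset.sum_mul]
  rw [Finset.sum_comm]
  refine Finset.sum_congr rfl fun a _ => ?_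
  simp

theorem prob_le_prob_comp [Fintype α] (A : Ω → α) (f : α → β) (a : α) :
    prob P A a ≤ prob P (fun ω => f (A ω)) (f a) := by
  classical
  rw [prob_comp P A f]
  have := Finset.single_le_sum (f := fun a' => if f a' = f a then prob P A a' else 0)
    (fun a' _ => by split_ifs; exacts [prob_nonneg _ _ _, le_rfl]) (Finset.mem_univ a)
  simpa using this

theorem sum_prob_pair [Fintype α] [Fintype β] (A : Ω → α) (B : Ω → β) (b : β) :
    ∑ a, prob P (fun ω => (A ω, B ω)) (a, b) = prob P B b := by
  classical
  have := prob_comp P (fun ω => (A ω, B ω)) Prod.snd b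
  simp only at this
  rw [this, Fintype.sum_prod_type]
  simp

open Classical in
theorem prob_comp_left [Fintype α] [Fintype γ] (A : Ω → α) (C : Ω → γ) (f : α → β) (b : β)
    (c : γ) : prob P (fun ω => (f (A ω), C ω)) (b, c) =
      ∑ a, if f a = b then prob P (fun ω => (A ω, C ω)) (a, c) else 0 := by
  have := prob_comp P (fun ω => (A ω, C ω)) (Prod.map f id) (b, c)
  simp only [Prod.map, id] at this
  rw [this, Fintype.sum_prod_type]
  refine Finset.sum_congr rfl fun a _ => ?_
  simp only [Prod.mk.injEq]
  by_cases h : f a = b <;> simp [h]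

variable {P} in
theorem IsMarkovChain.comp_left {δ : Type*} [Fintype α] [Fintype β] [Fintype γ] {A : Ω → α}
    {B : Ω → β} {C : Ω → γ} (h : IsMarkovChain P A B C) (f : α → δ) :
    IsMarkovChain P (fun ω => f (A ω)) B C := by
  classical
  intro a b c
  rw [prob_comp_left P A (fun ω => (B ω, C ω)) f, prob_comp_left P A B f, Finset.sum_mul,
    Finset.sum_mul]
  refine Finset.sum_congr rfl fun a' _ => ?_
  split_ifs
  · exact h a' b c
  · simp

/-- The conditional probability `Pr[A = a | B = b]`, zero if `Pr[B = b] = 0`. -/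
noncomputable def condProb (A : Ω → α) (B : Ω → β) (a : α) (b : β) : ℝ :=
  prob P (fun ω => (A ω, B ω)) (a, b) / prob P B b

theorem condProb_nonneg (A : Ω → α) (B : Ω → β) (a : α) (b : β) : 0 ≤ condProb P A B a b :=
  div_nonneg (prob_nonneg _ _ _) (prob_nonneg _ _ _)

variable [Fintype α] [Fintype β]

theorem sum_condProb_le_one (A : Ω → α) (B : Ω → β) (b : β) : ∑ a, condProb P A B a b ≤ 1 := by
  simp only [condProb]
  rw [← Finset.sum_div, sum_prob_pair]
  exact div_self_le_one _

theorem prob_pair_le_right (A : Ω → α) (B : Ω → β) (a : α) (b : β) :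
    prob P (fun ω => (A ω, B ω)) (a, b) ≤ prob P B b :=
  prob_le_prob_comp P (fun ω => (A ω, B ω)) Prod.snd (a, b)

theorem prob_pair_le_left (A : Ω → α) (B : Ω → β) (a : α) (b : β) :
    prob P (fun ω => (A ω, B ω)) (a, b) ≤ prob P A a :=
  prob_le_prob_comp P (fun ω => (A ω, B ω)) Prod.fst (a, b)

theorem condProb_mul_prob (A : Ω → α) (B : Ω → β) (a : α) (b : β) :
    condProb P A B a b * prob P B b = prob P (fun ω => (A ω, B ω)) (a, b) := by
  rw [condProb]
  refine div_mul_cancel_of_imp fun h => ?_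
  exact le_antisymm ((prob_pair_le_right P A B a b).trans_eq h) (prob_nonneg _ _ _)

theorem condProb_pos {A : Ω → α} {B : Ω → β} {a : α} {b : β}
    (h : 0 < prob P (fun ω => (A ω, B ω)) (a, b)) : 0 < condProb P A B a b :=
  div_pos h (h.trans_le (prob_pair_le_right P A B a b))

theorem prob_swap (A : Ω → α) (B : Ω → β) (a : α) (b : β) :
    prob P (fun ω => (B ω, A ω)) (b, a) = prob P (fun ω => (A ω, B ω)) (a, b) :=
  le_antisymm (prob_le_prob_comp P (fun ω => (B ω, A ω)) Prod.swap (b, a))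
    (prob_le_prob_comp P (fun ω => (A ω, B ω)) Prod.swap (a, b))

theorem mutualInfo_mul_log_two (A : Ω → α) (B : Ω → β) :
    mutualInfo P A B * Real.log 2 = ∑ ab : α × β, prob P (fun ω => (A ω, B ω)) ab *
      Real.log (condProb P A B ab.1 ab.2 / prob P A ab.1) := by
  have h2 : Real.log 2 ≠ 0 := (Real.log_pos one_lt_two).ne'
  rw [mutualInfo, Fintype.sum_prod_type, Finset.sum_mul]
  refine Finset.sum_congr rfl fun a _ => ?_
  rw [Finset.sum_mul]
  refine Finset.sum_congr rfl fun b _ => ?_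
  rw [mul_assoc, Real.logb, div_mul_cancel₀ _ h2, condProb, div_div, mul_comm (prob P B b)]

/-- By the Markov chain, `Pr[a,b,c] = Pr[a,c] Pr[b|a]`, so the information density is the ratio of
encoder weight to decoder weight. -/
theorem condMutualInfo_mul_log_two [Fintype γ] {A : Ω → α} {B : Ω → β} {C : Ω → γ}
    (h : IsMarkovChain P C A B) :
    condMutualInfo P A B C * Real.log 2 = ∑ abc : α × β × γ,
      prob P (fun ω => (A ω, B ω, C ω)) abc *
        Real.log (condProb P B A abc.2.1 abc.1 / condProb P B C abc.2.1 abc.2.2) := by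
  have h2 : Real.log 2 ≠ 0 := (Real.log_pos one_lt_two).ne'
  rw [condMutualInfo, Finset.sum_mul, Fintype.sum_prod_type]
  refine Finset.sum_congr rfl fun a _ => ?_
  rw [Finset.sum_mul, Fintype.sum_prod_type]
  refine Finset.sum_congr rfl fun b _ => ?_
  rw [Finset.sum_mul]
  refine Finset.sum_congr rfl fun c _ => ?_
  rw [mul_assoc, Real.logb, div_mul_cancel₀ _ h2]
  rcases (prob_nonneg P (fun ω => (A ω, B ω, C ω)) (a, b, c)).eq_or_lt with h0 | h0
  · rw [← h0, zero_mul, zero_mul]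
  have hCAB : prob P (fun ω => (C ω, A ω, B ω)) (c, a, b) =
      prob P (fun ω => (A ω, B ω, C ω)) (a, b, c) :=
    le_antisymm (prob_le_prob_comp P (fun ω => (C ω, A ω, B ω)) (fun t => (t.2.1, t.2.2, t.1)) _)
      (prob_le_prob_comp P (fun ω => (A ω, B ω, C ω)) (fun t => (t.2.2, t.1, t.2.1)) _)
  have hm := h c a b
  rw [hCAB, prob_swap P A C, prob_swap P B A] at hm
  have hA : 0 < prob P A a := h0.trans_le (prob_le_prob_comp P _ (fun t => t.1) (a, b, c))
  have hC : 0 < prob P C c := h0.trans_le (prob_le_prob_comp P _ (fun t => t.2.2) (a, b, c))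
  have hAC : 0 < prob P (fun ω => (A ω, C ω)) (a, c) :=
    h0.trans_le (prob_le_prob_comp P _ (fun t => (t.1, t.2.2)) (a, b, c))
  have hBC : 0 < prob P (fun ω => (B ω, C ω)) (b, c) :=
    h0.trans_le (prob_le_prob_comp P _ (fun t => (t.2.1, t.2.2)) (a, b, c))
  congr 2
  rw [condProb, condProb]
  field_simp
  rw [hm]

end Prob

/-! ### Sums over words and Chernoff bounds -/

section Words

variable {𝒳 𝒮 𝒰 𝒵 𝒯 𝒱 𝒴 : Type*} [Fintype 𝒳] [Fintype 𝒮] [Fintype 𝒰] [Fintype 𝒵] [Fintype 𝒯]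
  [Fintype 𝒱] [Fintype 𝒴] {m n : ℕ}

theorem sum_word_prod {α : Type*} [Fintype α] (f : Fin n → α → ℝ) :
    ∑ a : Fin n → α, ∏ i, f i (a i) = ∏ i, ∑ a, f i a :=
  (Fintype.prod_sum f).symm

theorem sum_words_factor (q : ℝ) (A : Fin n → 𝒴 → 𝒵 → ℝ) (B : Fin m → 𝒯 → 𝒰 → 𝒱 → ℝ) :
    ∑ c : (Fin n → 𝒵) × (Fin m → 𝒯), ∑ u : Fin m → 𝒰, ∑ y : Fin n → 𝒴, ∑ v : Fin m → 𝒱,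
        q * (∏ i, A i (y i) (c.1 i)) * ∏ j, B j (c.2 j) (u j) (v j) =
      q * (∏ i, ∑ yz : 𝒴 × 𝒵, A i yz.1 yz.2) *
        ∏ j, ∑ r : 𝒯 × 𝒰 × 𝒱, B j r.1 r.2.1 r.2.2 := by
  simp only [Fintype.sum_prod_type]
  simp_rw [← Finset.mul_sum, ← Finset.sum_mul, ← Finset.mul_sum, ← Finset.sum_mul,
    ← Finset.mul_sum]
  congr 1
  · congr 1
    calc _ = ∑ z : Fin n → 𝒵, ∏ i, ∑ y, A i y (z i) :=
          Finset.sum_congr rfl fun z _ => sum_word_prod fun i y => A i y (z i)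
      _ = ∏ i, ∑ z, ∑ y, A i y z := sum_word_prod fun i z => ∑ y, A i y z
      _ = _ := Finset.prod_congr rfl fun i _ => Finset.sum_comm
  · calc _ = ∑ t : Fin m → 𝒯, ∑ u : Fin m → 𝒰, ∏ j, ∑ v, B j (t j) (u j) v :=
          Finset.sum_congr rfl fun t _ => Finset.sum_congr rfl fun u _ =>
            sum_word_prod fun j v => B j (t j) (u j) v
      _ = ∑ t : Fin m → 𝒯, ∏ j, ∑ u, ∑ v, B j (t j) u v :=
          Finset.sum_congr rfl fun t _ => sum_word_prod fun j u => ∑ v, B j (t j) u v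
      _ = _ := sum_word_prod fun j t => ∑ u, ∑ v, B j t u v

/-- With `r = P / R` the right side is `P / (1 + r) ≥ P * (1 - min 1 r)`, and `min 1 r ≤ r ^ l` for
`l` in `[0, 1]`. The power, unlike the harmonic expression, factors over letters. -/
theorem mul_one_sub_rpow_le {P R l : ℝ} (hP : 0 < P) (hR : 0 < R) (hl0 : 0 ≤ l) (hl1 : l ≤ 1) :
    P * (1 - (P / R) ^ l) ≤ P * R / (P + R) := by
  have hr : 0 < P / R := div_pos hP hR
  rw [mul_div_assoc]
  refine mul_le_mul_of_nonneg_left ?_ hP.le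
  rcases le_total 1 (P / R) with h | h
  · have h1 := Real.one_le_rpow h hl0
    have h2 : 0 < R / (P + R) := by positivity
    linarith
  · have h1 : P / R ≤ (P / R) ^ l := by
      simpa using Real.rpow_le_rpow_of_exponent_ge hr h hl1
    have h2 : 1 - P / R ≤ R / (P + R) := by
      rw [le_div_iff₀ (by positivity)]
      have : (1 - P / R) * (P + R) = R - P * (P / R) := by field_simp; ring
      rw [this]
      have := mul_pos hP hr
      linarith
    linarith

/-- When the constraint fails, the total exponent is nonnegative and the product is at least one. -/
theorem indicator_not_le_prod_exp_rpow {D l : ℝ} (hl : 0 ≤ l) (d : Fin n → ℝ) :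
    1 - ∏ i, Real.exp (d i - D) ^ l ≤ truthValue (∑ i, d i ≤ n * D) := by
  by_cases h : ∑ i, d i ≤ n * D
  · rw [truthValue_of_true h]
    have : 0 ≤ ∏ i, Real.exp (d i - D) ^ l :=
      Finset.prod_nonneg fun i _ => Real.rpow_nonneg (Real.exp_pos _).le _
    linarith
  · rw [truthValue_of_not h]
    have h1 : 0 ≤ ∑ i, (d i - D) := by
      rw [Finset.sum_sub_distrib, Finset.sum_const, Finset.card_univ, Fintype.card_fin,
        nsmul_eq_mul]
      linarith
    rw [Real.finsetProd_rpow _ _ fun i _ => (Real.exp_pos _).le, ← Real.exp_sum]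
    have := Real.one_le_rpow (Real.one_le_exp h1) hl
    linarith

/-- The success probability of the one-shot code, for memoryless sources and channels, is bounded
below by a total mass minus two products of Chernoff factors. -/
theorem le_success_mass (pXY : 𝒳 → 𝒴 → ℝ) (W : 𝒰 → 𝒮 → 𝒱 → ℝ) (zx : 𝒳 → 𝒵 → ℝ) (ts : 𝒮 → 𝒯 → ℝ)
    (uts : 𝒮 → 𝒯 → 𝒰 → ℝ) (zy : 𝒴 → 𝒵 → ℝ) (tv : 𝒱 → 𝒯 → ℝ)
    (hpXY : ∀ x y, 0 ≤ pXY x y) (hW : ∀ u s v, 0 ≤ W u s v) (hzx : ∀ x z, 0 ≤ zx x z)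
    (hts : ∀ s t, 0 ≤ ts s t) (huts : ∀ s t u, 0 ≤ uts s t u)
    (hzy0 : ∀ y z, 0 ≤ zy y z) (htv0 : ∀ v t, 0 ≤ tv v t)
    (hzy : ∀ x y z, 0 < pXY x y * zx x z → 0 < zy y z)
    (htv : ∀ s t u v, 0 < ts s t * uts s t u * W u s v → 0 < tv v t)
    (q : (Fin n → 𝒳) → (Fin m → 𝒮) → ℝ) (hq : ∀ x s, 0 ≤ q x s) (A : Set (Fin m → 𝒮))
    (d : 𝒳 → 𝒴 → 𝒵 → ℝ) (D l l' : ℝ) (hl0 : 0 ≤ l) (hl1 : l ≤ 1) (hl' : 0 ≤ l') :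
    ∑ x, ∑ s, ((A.indicator (q x) s *
            (∏ i, ∑ yz : 𝒴 × 𝒵, pXY (x i) yz.1 * zx (x i) yz.2) *
            (∏ j, ∑ r : 𝒯 × 𝒰 × 𝒱, ts (s j) r.1 * uts (s j) r.1 r.2.1 * W r.2.1 (s j) r.2.2) -
          A.indicator (q x) s *
            (∏ i, ∑ yz : 𝒴 × 𝒵, pXY (x i) yz.1 * zx (x i) yz.2 *
              (zx (x i) yz.2 / zy yz.1 yz.2) ^ l) *
            (∏ j, ∑ r : 𝒯 × 𝒰 × 𝒱, ts (s j) r.1 * uts (s j) r.1 r.2.1 * W r.2.1 (s j) r.2.2 *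
              (ts (s j) r.1 / tv r.2.2 r.1) ^ l)) -
          A.indicator (q x) s *
            (∏ i, ∑ yz : 𝒴 × 𝒵, pXY (x i) yz.1 * zx (x i) yz.2 *
              Real.exp (d (x i) yz.1 yz.2 - D) ^ l') *
            (∏ j, ∑ r : 𝒯 × 𝒰 × 𝒱, ts (s j) r.1 * uts (s j) r.1 r.2.1 * W r.2.1 (s j) r.2.2)) ≤
      ∑ x, ∑ s, ∑ c : (Fin n → 𝒵) × (Fin m → 𝒯), ∑ u : Fin m → 𝒰, ∑ y : Fin n → 𝒴,
        ∑ v : Fin m → 𝒱,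
          (∏ i, pXY (x i) (y i)) * q x s * (∏ j, W (u j) (s j) (v j)) *
            (∏ j, uts (s j) (c.2 j) (u j)) *
            truthValue (∑ i, d (x i) (y i) (c.1 i) ≤ n * D) *
            ((∏ i, zx (x i) (c.1 i)) * (∏ j, ts (s j) (c.2 j)) *
                ((∏ i, zy (y i) (c.1 i)) * ∏ j, tv (v j) (c.2 j)) /
              ((∏ i, zx (x i) (c.1 i)) * (∏ j, ts (s j) (c.2 j)) +
                (∏ i, zy (y i) (c.1 i)) * ∏ j, tv (v j) (c.2 j))) := by
  refine Finset.sum_le_sum fun x _ => Finset.sum_le_sum fun s _ => ?_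
  rw [← sum_words_factor (A.indicator (q x) s) (fun i y z => pXY (x i) y * zx (x i) z)
      (fun j t u v => ts (s j) t * uts (s j) t u * W u (s j) v),
    ← sum_words_factor (A.indicator (q x) s) (fun i y z => pXY (x i) y * zx (x i) z *
      (zx (x i) z / zy y z) ^ l)
      (fun j t u v => ts (s j) t * uts (s j) t u * W u (s j) v * (ts (s j) t / tv v t) ^ l),
    ← sum_words_factor (A.indicator (q x) s) (fun i y z => pXY (x i) y * zx (x i) z *
      Real.exp (d (x i) y z - D) ^ l')
      (fun j t u v => ts (s j) t * uts (s j) t u * W u (s j) v)]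
  simp only [← Finset.sum_sub_distrib]
  refine Finset.sum_le_sum fun c _ => Finset.sum_le_sum fun u _ => Finset.sum_le_sum fun y _ =>
    Finset.sum_le_sum fun v _ => ?_
  simp only [Finset.prod_mul_distrib]
  set p := ∏ i, pXY (x i) (y i) with hp
  set w := ∏ j, W (u j) (s j) (v j) with hw
  set β := ∏ j, uts (s j) (c.2 j) (u j) with hβ
  set a := ∏ i, zx (x i) (c.1 i) with ha
  set b := ∏ j, ts (s j) (c.2 j) with hb
  set a' := ∏ i, zy (y i) (c.1 i) with ha'
  set b' := ∏ j, tv (v j) (c.2 j) with hb'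
  set E := ∏ i, Real.exp (d (x i) (y i) (c.1 i) - D) ^ l' with hE
  have hE1 := indicator_not_le_prod_exp_rpow (D := D) hl' fun i => d (x i) (y i) (c.1 i)
  rw [← hE] at hE1
  have hE0 : 0 ≤ E := Finset.prod_nonneg fun i _ => Real.rpow_nonneg (Real.exp_pos _).le _
  have hp0 : 0 ≤ p := Finset.prod_nonneg fun i _ => hpXY _ _
  have hw0 : 0 ≤ w := Finset.prod_nonneg fun i _ => hW _ _ _
  have hβ0 : 0 ≤ β := Finset.prod_nonneg fun i _ => huts _ _ _
  have ha0 : 0 ≤ a := Finset.prod_nonneg fun i _ => hzx _ _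
  have hb0 : 0 ≤ b := Finset.prod_nonneg fun i _ => hts _ _
  have ha'0 : 0 ≤ a' := Finset.prod_nonneg fun i _ => hzy0 _ _
  have hb'0 : 0 ≤ b' := Finset.prod_nonneg fun i _ => htv0 _ _
  set ok : ℝ := truthValue (∑ i, d (x i) (y i) (c.1 i) ≤ n * D) with hok
  have hok0 : 0 ≤ ok := truthValue_nonneg _
  have hrhs : 0 ≤ p * q x s * w * β * ok * (a * b * (a' * b') / (a * b + a' * b')) := by
    have := hq x s
    positivity
  by_cases hs : s ∈ A
  swap
  · simpa [Set.indicator_of_notMem hs] using hrhs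
  rw [Set.indicator_of_mem hs]
  have hr1 : ∏ i, (zx (x i) (c.1 i) / zy (y i) (c.1 i)) ^ l = (a / a') ^ l := by
    rw [Real.finsetProd_rpow _ _ fun i _ => div_nonneg (hzx _ _) (hzy0 _ _), Finset.prod_div_distrib]
  have hr2 : ∏ j, (ts (s j) (c.2 j) / tv (v j) (c.2 j)) ^ l = (b / b') ^ l := by
    rw [Real.finsetProd_rpow _ _ fun i _ => div_nonneg (hts _ _) (htv0 _ _), Finset.prod_div_distrib]
  rw [hr1, hr2]
  have hsplit : q x s * (p * a) * (b * β * w) -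
      q x s * (p * a * (a / a') ^ l) * (b * β * w * (b / b') ^ l) -
      q x s * (p * a * E) * (b * β * w) =
      p * q x s * w * β * (a * b * (1 - E) - a * b * (a * b / (a' * b')) ^ l) := by
    rw [mul_div_mul_comm, Real.mul_rpow (div_nonneg ha0 ha'0) (div_nonneg hb0 hb'0)]
    ring
  rw [hsplit]
  have hfac : 0 ≤ p * q x s * w * β := by
    have := hq x s
    positivity
  rcases (mul_nonneg (mul_nonneg hfac ha0) hb0).eq_or_lt with h0 | h0
  · refine le_of_eq_of_le ?_ hrhs
    linear_combination (-(1 - E) + (a * b / (a' * b')) ^ l) * h0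
  -- Where the mass is positive, so is every letter factor. The decoder weights are then positive
  -- too, and no ratio is a division by zero.
  have hposfac : 0 < (∏ i, pXY (x i) (y i) * zx (x i) (c.1 i)) *
      ∏ j, ts (s j) (c.2 j) * uts (s j) (c.2 j) (u j) * W (u j) (s j) (v j) := by
    simp only [Finset.prod_mul_distrib]
    refine lt_of_le_of_ne (by positivity) fun h => ?_
    have : p * q x s * w * β * a * b = q x s * (p * a * (b * β * w)) := by ring
    rw [this, ← h, mul_zero] at h0
    exact lt_irrefl _ h0
  have hA : ∀ i, 0 < pXY (x i) (y i) * zx (x i) (c.1 i) := fun i =>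
    lt_of_le_of_ne (mul_nonneg (hpXY _ _) (hzx _ _)) fun h =>
      left_ne_zero_of_mul hposfac.ne' (Finset.prod_eq_zero (Finset.mem_univ i) h.symm)
  have hB : ∀ j, 0 < ts (s j) (c.2 j) * uts (s j) (c.2 j) (u j) * W (u j) (s j) (v j) := fun j =>
    lt_of_le_of_ne (mul_nonneg (mul_nonneg (hts _ _) (huts _ _ _)) (hW _ _ _)) fun h =>
      right_ne_zero_of_mul hposfac.ne' (Finset.prod_eq_zero (Finset.mem_univ j) h.symm)
  have ha1 : 0 < a := Finset.prod_pos fun i _ => pos_of_mul_pos_right (hA i) (hpXY _ _)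
  have hb1 : 0 < b := Finset.prod_pos fun j _ =>
    lt_of_le_of_ne (hts _ _) fun h => (hB j).ne' (by rw [← h]; ring)
  have ha'1 : 0 < a' := Finset.prod_pos fun i _ => hzy _ _ _ (hA i)
  have hb'1 : 0 < b' := Finset.prod_pos fun j _ => htv _ _ _ _ (hB j)
  rw [mul_assoc _ ok]
  refine mul_le_mul_of_nonneg_left ?_ hfac
  have hmain := mul_one_sub_rpow_le (mul_pos ha1 hb1) (mul_pos ha'1 hb'1) hl0 hl1
  set g := (a * b / (a' * b')) ^ l with hg
  set f := a * b * (a' * b') / (a * b + a' * b') with hf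
  have hab := mul_pos ha1 hb1
  have hf0 : 0 ≤ f := by positivity
  have hg0 : 0 ≤ g := by positivity
  -- If the distortion is acceptable, the term with `E` is dropped; otherwise `E ≥ 1` makes the left
  -- side nonpositive.
  by_cases h : ∑ i, d (x i) (y i) (c.1 i) ≤ n * D
  · rw [hok, truthValue_of_true h, one_mul]
    have := mul_nonneg hab.le hE0
    linarith
  · rw [hok, truthValue_of_not h, zero_mul]
    rw [hok, truthValue_of_not h] at hE1
    have h1 := mul_nonneg hab.le hg0
    have h2 := mul_nonneg hab.le (sub_nonneg.2 (by linarith : 1 ≤ E))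
    linarith

end Words

/-! ### Typical state words -/

section Typical

/-- The tolerance is relative to `p a`, so a letter of probability zero cannot occur at all. -/
theorem pos_of_mem_typicalSet {𝒮 : Type*} {m : ℕ} {η : ℝ} {p : PMF 𝒮} {s : Fin m → 𝒮}
    (hs : s ∈ typicalSet η m p) (j : Fin m) : 0 < (p (s j)).toReal := by
  classical
  have hm' : (0 : ℝ) < m := Nat.cast_pos.2 (Fin.pos j)
  refine lt_of_le_of_ne ENNReal.toReal_nonneg fun h => ?_
  have h1 := hs (s j)
  rw [← h, sub_zero, mul_zero] at h1
  have h2 : 0 < occurrences s (s j) := Finset.card_pos.2 ⟨j, by simp⟩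
  have h3 : (0 : ℝ) < (occurrences s (s j) : ℝ) / m := div_pos (Nat.cast_pos.2 h2) hm'
  exact absurd h1 (not_le.2 (h3.trans_le (le_abs_self _)))

/-- The logarithm of the product is `m` times the empirical mean of `log b`, and each frequency
deviates from `p a` by at most `η * p a`. -/
theorem prod_le_exp_of_mem_typicalSet {𝒮 : Type*} [Fintype 𝒮] {m : ℕ} (hm : 0 < m) {η : ℝ}
    {p : PMF 𝒮} {s : Fin m → 𝒮} (hs : s ∈ typicalSet η m p) (b : 𝒮 → ℝ)
    (hb : ∀ a, 0 < (p a).toReal → 0 < b a) :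
    ∏ j, b (s j) ≤ Real.exp (m * (∑ a, (p a).toReal * Real.log (b a) +
      η * ∑ a, (p a).toReal * |Real.log (b a)|)) := by
  classical
  have hm' : (0 : ℝ) < m := Nat.cast_pos.2 hm
  have hpos : ∀ j, 0 < b (s j) := fun j => hb _ (pos_of_mem_typicalSet hs j)
  have hsum : ∑ j, Real.log (b (s j)) = ∑ a, (occurrences s a : ℝ) * Real.log (b a) := by
    rw [← Finset.sum_fiberwise_of_maps_to (s := Finset.univ) (t := Finset.univ) (g := s)
      (fun _ _ => Finset.mem_univ _)]
    refine Finset.sum_congr rfl fun a _ => ?_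
    rw [Finset.sum_congr rfl (g := fun _ => Real.log (b a)), Finset.sum_const, nsmul_eq_mul]
    · congr 2
    · intro j hj
      rw [(Finset.mem_filter.1 hj).2]
  have hprod : ∏ j, b (s j) = Real.exp (∑ j, Real.log (b (s j))) := by
    rw [Real.exp_sum]
    exact Finset.prod_congr rfl fun j _ => (Real.exp_log (hpos j)).symm
  rw [hprod, hsum, Finset.mul_sum, ← Finset.sum_add_distrib, Finset.mul_sum]
  refine Real.exp_le_exp.2 (Finset.sum_le_sum fun a _ => ?_)
  have h1 : ((occurrences s a : ℝ) / m - (p a).toReal) * Real.log (b a) ≤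
      η * (p a).toReal * |Real.log (b a)| :=
    (le_abs_self _).trans ((abs_mul _ _).trans_le
      (mul_le_mul_of_nonneg_right (hs a) (abs_nonneg _)))
  have h2 : (occurrences s a : ℝ) * Real.log (b a) =
      m * ((p a).toReal * Real.log (b a) +
        ((occurrences s a : ℝ) / m - (p a).toReal) * Real.log (b a)) := by
    field_simp; ring
  rw [h2]
  refine mul_le_mul_of_nonneg_left ?_ hm'.le
  linarith

end Typical

/-! ### Logarithmic moments near order zero -/

section Moments

/-- Terms with `p i = 0` vanish identically, so positivity of `r i` is needed only on the support.
-/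
theorem hasDerivAt_log_sum_rpow {ι : Type*} [Fintype ι] (p r : ι → ℝ) (hp : ∀ i, 0 ≤ p i)
    (hp1 : ∑ i, p i = 1) (hr : ∀ i, 0 < p i → 0 < r i) :
    HasDerivAt (fun l : ℝ => Real.log (∑ i, p i * r i ^ l)) (∑ i, p i * Real.log (r i)) 0 := by
  have h : HasDerivAt (fun l : ℝ => ∑ i, p i * r i ^ l) (∑ i, p i * Real.log (r i)) 0 := by
    refine HasDerivAt.fun_sum fun i _ => ?_
    rcases (hp i).eq_or_lt with h0 | h0
    · simpa [← h0] using hasDerivAt_const (0 : ℝ) (0 : ℝ)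
    · have := ((Real.hasStrictDerivAt_const_rpow (hr i h0) 0).hasDerivAt).const_mul (p i)
      simpa using this
  have h2 := h.log (by simp [hp1])
  simpa [hp1] using h2

theorem exists_neg_of_hasDerivAt {φ : ℝ → ℝ} {φ' : ℝ} (h : HasDerivAt φ φ' 0) (h0 : φ 0 = 0)
    (hneg : φ' < 0) : ∃ l, 0 < l ∧ l ≤ 1 ∧ φ l < 0 := by
  have h1 := (hasDerivAt_iff_tendsto_slope_zero.1 h).eventually (gt_mem_nhds hneg)
  have h2 : ∀ᶠ t in nhdsWithin (0 : ℝ) (Set.Ioi 0), t⁻¹ • (φ (0 + t) - φ 0) < 0 :=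
    h1.filter_mono (nhdsWithin_mono _ fun x hx => ne_of_gt hx)
  have h3 : ∀ᶠ t in nhdsWithin (0 : ℝ) (Set.Ioi 0), t ∈ Set.Ioc (0 : ℝ) 1 :=
    Ioc_mem_nhdsGT one_pos
  obtain ⟨t, ht, ht0, ht1⟩ := (h2.and h3).exists
  refine ⟨t, ht0, ht1, ?_⟩
  rw [zero_add, h0, sub_zero, smul_eq_mul] at ht
  exact (mul_neg_iff.1 ht).elim (fun h => h.2) fun h => absurd h.1 (not_lt.2 (inv_pos.2 ht0).le)

end Moments

/-! ### Single-letter laws and information as mean log-ratios -/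

section Letters

variable {Ω : Type*} (P : PMF Ω)

theorem prob_reindex {α β : Type*} [Fintype α] [Fintype β] {A : Ω → α} {B : Ω → β} (f : α → β)
    (g : β → α) (hf : ∀ ω, f (A ω) = B ω) (hg : ∀ ω, g (B ω) = A ω) {a : α} {b : β}
    (hab : f a = b) (hba : g b = a) : prob P A a = prob P B b := by
  refine le_antisymm ?_ ?_
  · simpa only [hf, hab] using prob_le_prob_comp P A f a
  · simpa only [hg, hba] using prob_le_prob_comp P B g b

theorem sum_condProb_eq_one {α β : Type*} [Fintype α] [Fintype β] (A : Ω → α) (B : Ω → β) {b : β}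
    (hb : 0 < prob P B b) : ∑ a, condProb P A B a b = 1 := by
  simp only [condProb]
  rw [← Finset.sum_div, sum_prob_pair, div_self hb.ne']

variable {P}

theorem IsMarkovChain.prob_eq_mul_condProb {α β γ : Type*} [Fintype α] [Fintype β] [Fintype γ]
    {A : Ω → α} {B : Ω → β} {C : Ω → γ} (h : IsMarkovChain P A B C) (a : α) (b : β) (c : γ) :
    prob P (fun ω => (B ω, A ω, C ω)) (b, a, c) =
      prob P (fun ω => (B ω, A ω)) (b, a) * condProb P C B c b := by
  have h1 : prob P (fun ω => (A ω, B ω, C ω)) (a, b, c) =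
      prob P (fun ω => (B ω, A ω, C ω)) (b, a, c) :=
    prob_reindex P (fun t => (t.2.1, t.1, t.2.2)) (fun t => (t.2.1, t.1, t.2.2))
      (fun _ => rfl) (fun _ => rfl) rfl rfl
  have h2 := h a b c
  rw [h1, prob_swap P B A, prob_swap P C B, ← condProb_mul_prob P C B] at h2
  rcases (prob_nonneg P B b).eq_or_lt with h0 | h0
  · have h3 : prob P (fun ω => (B ω, A ω)) (b, a) = 0 :=
      le_antisymm ((prob_pair_le_left P B A b a).trans_eq h0.symm) (prob_nonneg _ _ _)
    have h4 := prob_pair_le_left P B (fun ω => (A ω, C ω)) b (a, c)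
    rw [h3, zero_mul]
    exact le_antisymm (h4.trans_eq h0.symm) (prob_nonneg _ _ _)
  · exact mul_right_cancel₀ h0.ne' (h2.trans (mul_assoc _ _ _).symm)

/-- The joint law of state, auxiliary, input and output, factored along the encoding order. -/
theorem prob_state_channel {𝒮 𝒯 𝒰 𝒱 : Type*} [Fintype 𝒮] [Fintype 𝒯] [Fintype 𝒰] [Fintype 𝒱]
    {S : Ω → 𝒮} {T : Ω → 𝒯} {U : Ω → 𝒰} {V : Ω → 𝒱} {W : 𝒰 → 𝒮 → 𝒱 → ℝ}
    (hV : ∀ u s v, prob P (fun ω => (U ω, S ω, V ω)) (u, s, v) =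
      prob P (fun ω => (U ω, S ω)) (u, s) * W u s v)
    (hTUSV : IsMarkovChain P T (fun ω => (U ω, S ω)) V) (s : 𝒮) (t : 𝒯) (u : 𝒰) (v : 𝒱) :
    prob P (fun ω => (S ω, T ω, U ω, V ω)) (s, t, u, v) =
      prob P S s * (condProb P T S t s * condProb P U (fun ω => (T ω, S ω)) u (t, s) * W u s v) := by
  have e1 : prob P S s * (condProb P T S t s * condProb P U (fun ω => (T ω, S ω)) u (t, s)) =
      prob P (fun ω => (U ω, T ω, S ω)) (u, t, s) := by
    rw [← mul_assoc, mul_comm (prob P S s), condProb_mul_prob, mul_comm, condProb_mul_prob]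
  have e2 : prob P (fun ω => ((U ω, S ω), T ω)) ((u, s), t) =
      prob P (fun ω => (U ω, T ω, S ω)) (u, t, s) :=
    prob_reindex P (fun r => (r.1.1, r.2, r.1.2)) (fun r => ((r.1, r.2.2), r.2.1))
      (fun _ => rfl) (fun _ => rfl) rfl rfl
  have e3 : prob P (fun ω => ((U ω, S ω), T ω, V ω)) ((u, s), t, v) =
      prob P (fun ω => (S ω, T ω, U ω, V ω)) (s, t, u, v) :=
    prob_reindex P (fun r => (r.1.2, r.2.1, r.1.1, r.2.2))
      (fun r => ((r.2.2.1, r.1), r.2.1, r.2.2.2)) (fun _ => rfl) (fun _ => rfl) rfl rfl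
  have e4 : prob P (fun ω => (V ω, U ω, S ω)) (v, u, s) =
      prob P (fun ω => (U ω, S ω, V ω)) (u, s, v) :=
    prob_reindex P (fun r => (r.2.1, r.2.2, r.1)) (fun r => (r.2.2, r.1, r.2.1))
      (fun _ => rfl) (fun _ => rfl) rfl rfl
  have h := hTUSV.prob_eq_mul_condProb t (u, s) v
  rw [e2, e3] at h
  rw [h, ← mul_assoc (prob P S s), e1]
  -- The conditional law of `V` is tied to `W` only where `(u, s)` has positive probability;
  -- elsewhere both sides vanish.
  rcases (prob_nonneg P (fun ω => (U ω, S ω)) (u, s)).eq_or_lt with h0 | h0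
  · have : prob P (fun ω => (U ω, T ω, S ω)) (u, t, s) = 0 := by
      rw [← e2]
      exact le_antisymm ((prob_pair_le_left P (fun ω => (U ω, S ω)) T _ _).trans_eq h0.symm)
        (prob_nonneg _ _ _)
    rw [this, zero_mul, zero_mul]
  · rw [condProb, e4, hV, mul_div_cancel_left₀ _ h0.ne']

/-- The average is taken over the full side information `Y`, with `f` the projection to one
receiver, because the code is analysed under the joint law of all receivers. -/
theorem condMutualInfo_mul_log_two_joint {𝒳 𝒴 𝒴' 𝒵 : Type*} [Fintype 𝒳] [Fintype 𝒴] [Fintype 𝒴']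
    [Fintype 𝒵] {X : Ω → 𝒳} {Y : Ω → 𝒴} {Z : Ω → 𝒵} (h : IsMarkovChain P Y X Z) (f : 𝒴 → 𝒴') :
    condMutualInfo P X Z (fun ω => f (Y ω)) * Real.log 2 = ∑ w : 𝒳 × 𝒴 × 𝒵,
      prob P (fun ω => (X ω, Y ω)) (w.1, w.2.1) * condProb P Z X w.2.2 w.1 *
        Real.log (condProb P Z X w.2.2 w.1 / condProb P Z (fun ω => f (Y ω)) w.2.2 (f w.2.1)) := by
  rw [condMutualInfo_mul_log_two P (h.comp_left f)]
  have := sum_prob_comp_mul P (fun ω => (X ω, Y ω, Z ω)) (fun w => (w.1, w.2.2, f w.2.1))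
    (fun w => Real.log (condProb P Z X w.2.1 w.1 / condProb P Z (fun ω => f (Y ω)) w.2.1 w.2.2))
  simp only at this
  rw [this]
  refine Finset.sum_congr rfl fun w _ => ?_
  rw [← h.prob_eq_mul_condProb]

/-- `Pr[T = t]` cancels in the difference of the two information densities. -/
theorem mutualInfo_sub_mul_log_two {𝒮 𝒯 𝒱 𝒱' 𝒰 : Type*} [Fintype 𝒮] [Fintype 𝒯] [Fintype 𝒱]
    [Fintype 𝒱'] [Fintype 𝒰] (S : Ω → 𝒮) (T : Ω → 𝒯) (U : Ω → 𝒰) (V : Ω → 𝒱) (f : 𝒱 → 𝒱') :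
    (mutualInfo P T S - mutualInfo P T (fun ω => f (V ω))) * Real.log 2 =
      ∑ w : 𝒮 × 𝒯 × 𝒰 × 𝒱, prob P (fun ω => (S ω, T ω, U ω, V ω)) w *
        Real.log (condProb P T S w.2.1 w.1 /
          condProb P T (fun ω => f (V ω)) w.2.1 (f w.2.2.2)) := by
  rw [sub_mul, mutualInfo_mul_log_two, mutualInfo_mul_log_two]
  have h1 := sum_prob_comp_mul P (fun ω => (S ω, T ω, U ω, V ω)) (fun w => (w.2.1, w.1))
    (fun w => Real.log (condProb P T S w.1 w.2 / prob P T w.1))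
  have h2 := sum_prob_comp_mul P (fun ω => (S ω, T ω, U ω, V ω)) (fun w => (w.2.1, f w.2.2.2))
    (fun w => Real.log (condProb P T (fun ω => f (V ω)) w.1 w.2 / prob P T w.1))
  simp only at h1 h2
  rw [h1, h2, ← Finset.sum_sub_distrib]
  refine Finset.sum_congr rfl fun w _ => ?_
  rcases (prob_nonneg P (fun ω => (S ω, T ω, U ω, V ω)) w).eq_or_lt with h0 | h0
  · rw [← h0]; ring
  have hT : 0 < prob P T w.2.1 := h0.trans_le (prob_le_prob_comp P _ (fun w => w.2.1) w)
  have hTS : 0 < condProb P T S w.2.1 w.1 :=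
    condProb_pos P (h0.trans_le (prob_le_prob_comp P _ (fun w => (w.2.1, w.1)) w))
  have hTV : 0 < condProb P T (fun ω => f (V ω)) w.2.1 (f w.2.2.2) :=
    condProb_pos P (h0.trans_le (prob_le_prob_comp P _ (fun w => (w.2.1, f w.2.2.2)) w))
  rw [Real.log_div hTS.ne' hT.ne', Real.log_div hTV.ne' hT.ne', Real.log_div hTS.ne' hTV.ne']
  ring

end Letters

/-! ### Bounds for sums over source and state words -/

section Sums

variable {𝒳 𝒮 : Type*} [Fintype 𝒳] [Fintype 𝒮] {m n : ℕ}

theorem sum_mul_rpow_pos {ι : Type*} [Fintype ι] {p r : ι → ℝ} (hp : ∀ i, 0 ≤ p i)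
    (hp1 : ∑ i, p i = 1) (hr : ∀ i, 0 < p i → 0 < r i) (hr0 : ∀ i, 0 ≤ r i) (l : ℝ) :
    0 < ∑ i, p i * r i ^ l := by
  obtain ⟨i, -, hi⟩ := Finset.exists_ne_zero_of_sum_ne_zero (hp1.trans_ne one_ne_zero)
  have hi' : 0 < p i := lt_of_le_of_ne (hp i) (Ne.symm hi)
  exact Finset.sum_pos' (fun j _ => mul_nonneg (hp j) (Real.rpow_nonneg (hr0 j) l))
    ⟨i, Finset.mem_univ i, mul_pos hi' (Real.rpow_pos_of_pos (hr i hi') l)⟩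

/-- The state factor is bounded uniformly on `A` before averaging, so `q` may depend on `x`; the
source factor then sums to an `n`-th power. -/
theorem sum_indicator_mul_prod_le {q : (Fin n → 𝒳) → (Fin m → 𝒮) → ℝ} (hq : ∀ x s, 0 ≤ q x s)
    (hq1 : ∀ x, ∑ s, q x s ≤ 1) (A : Set (Fin m → 𝒮)) {a : 𝒳 → ℝ} (ha : ∀ x, 0 ≤ a x)
    {b : 𝒮 → ℝ} {B : ℝ} (hB0 : 0 ≤ B)
    (hB : ∀ s ∈ A, ∏ j, b (s j) ≤ B) :
    ∑ x : Fin n → 𝒳, ∑ s : Fin m → 𝒮, A.indicator (q x) s * (∏ i, a (x i)) * ∏ j, b (s j) ≤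
      (∑ x, a x) ^ n * B := by
  have hpow : (∑ x, a x) ^ n = ∑ x : Fin n → 𝒳, ∏ i, a (x i) := by
    rw [sum_word_prod fun _ => a]; simp
  rw [hpow, Finset.sum_mul]
  refine Finset.sum_le_sum fun x _ => ?_
  have hax : 0 ≤ ∏ i, a (x i) := Finset.prod_nonneg fun i _ => ha _
  calc _ ≤ ∑ s, q x s * ((∏ i, a (x i)) * B) := by
        refine Finset.sum_le_sum fun s _ => ?_
        by_cases hs : s ∈ A
        · rw [Set.indicator_of_mem hs, mul_assoc]
          exact mul_le_mul_of_nonneg_left (mul_le_mul_of_nonneg_left (hB s hs) hax) (hq x s)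
        · rw [Set.indicator_of_notMem hs, zero_mul, zero_mul]
          exact mul_nonneg (hq x s) (mul_nonneg hax hB0)
    _ ≤ _ := by
        rw [← Finset.sum_mul]
        exact mul_le_of_le_one_left (mul_nonneg hax hB0) (hq1 x)

theorem sum_toReal_pmf {α : Type*} [Fintype α] (p : PMF α) : ∑ a, (p a).toReal = 1 := by
  have h := p.tsum_coe
  rw [tsum_fintype] at h
  rw [← ENNReal.toReal_one, ← h, ENNReal.toReal_sum fun a _ => PMF.apply_ne_top _ _]

theorem exists_nat_forall_exp_mul_le {ι : Type*} [Finite ι] {c : ι → ℝ} (hc : ∀ i, c i < 0) {δ : ℝ}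
    (hδ : 0 < δ) : ∃ n₀ : ℕ, ∀ n : ℕ, n₀ ≤ n → ∀ i, Real.exp (n * c i) ≤ δ := by
  have h : ∀ i, ∀ᶠ n : ℕ in Filter.atTop, Real.exp (n * c i) ≤ δ := fun i =>
    ((Real.tendsto_exp_atBot.comp
      (tendsto_natCast_atTop_atTop.atTop_mul_const_of_neg (hc i))).eventually (ge_mem_nhds hδ))
  exact Filter.eventually_atTop.1 (Filter.eventually_all.2 h)

end Sums

/-! ### Negative error exponents -/

section Exponents

variable {Ω Ω' : Type*} {P : PMF Ω} {P' : PMF Ω'}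

theorem sum_prob_mul_condProb {𝒳 𝒴 𝒵 : Type*} [Fintype 𝒳] [Fintype 𝒴] [Fintype 𝒵] {X : Ω → 𝒳}
    {Y : Ω → 𝒴} {Z : Ω → 𝒵} (h : IsMarkovChain P Y X Z) :
    ∑ w : 𝒳 × 𝒴 × 𝒵, prob P (fun ω => (X ω, Y ω)) (w.1, w.2.1) * condProb P Z X w.2.2 w.1 = 1 := by
  rw [← sum_prob P (fun ω => (X ω, Y ω, Z ω))]
  exact Finset.sum_congr rfl fun w _ => (h.prob_eq_mul_condProb w.2.1 w.1 w.2.2).symm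

theorem condProb_side_pos {𝒳 𝒴 𝒴' 𝒵 : Type*} [Fintype 𝒳] [Fintype 𝒴] [Fintype 𝒴'] [Fintype 𝒵]
    {X : Ω → 𝒳} {Y : Ω → 𝒴} {Z : Ω → 𝒵} (h : IsMarkovChain P Y X Z) (f : 𝒴 → 𝒴') {x : 𝒳} {y : 𝒴}
    {z : 𝒵} (h0 : 0 < prob P (fun ω => (X ω, Y ω)) (x, y) * condProb P Z X z x) :
    0 < condProb P Z (fun ω => f (Y ω)) z (f y) := by
  rw [← h.prob_eq_mul_condProb] at h0
  exact condProb_pos P (h0.trans_le (prob_le_prob_comp P _ (fun w => (w.2.2, f w.2.1)) (x, y, z)))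

/-- The derivative of the exponent at order zero is the mean of `d i - D`. -/
theorem exists_distortion_exponent {ι : Type*} [Fintype ι] {p d : ι → ℝ} (hp : ∀ i, 0 ≤ p i)
    (hp1 : ∑ i, p i = 1) {D : ℝ} (hd : ∑ i, p i * d i < D) :
    ∃ l : ℝ, 0 < l ∧ l ≤ 1 ∧ Real.log (∑ i, p i * Real.exp (d i - D) ^ l) < 0 := by
  refine exists_neg_of_hasDerivAt
    (hasDerivAt_log_sum_rpow p _ hp hp1 fun i _ => Real.exp_pos _) (by simp [hp1]) ?_
  simp only [Real.log_exp, mul_sub, Finset.sum_sub_distrib, ← Finset.sum_mul, hp1, one_mul]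
  linarith

variable {𝒮 𝒯 𝒰 𝒱 𝒱' : Type*} [Fintype 𝒮] [Fintype 𝒯] [Fintype 𝒰] [Fintype 𝒱] [Fintype 𝒱']
  {S : Ω' → 𝒮} {T : Ω' → 𝒯} {U : Ω' → 𝒰} {V : Ω' → 𝒱} {W : 𝒰 → 𝒮 → 𝒱 → ℝ}

theorem sum_condProb_channel (hW1 : ∀ u s, ∑ v, W u s v = 1) {s : 𝒮} (hs : 0 < prob P' S s) :
    ∑ r : 𝒯 × 𝒰 × 𝒱, condProb P' T S r.1 s *
      condProb P' U (fun ω => (T ω, S ω)) r.2.1 (r.1, s) * W r.2.1 s r.2.2 = 1 := by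
  simp only [Fintype.sum_prod_type]
  simp_rw [← Finset.mul_sum, hW1, mul_one, ← Finset.mul_sum]
  rw [← sum_condProb_eq_one P' T S hs]
  refine Finset.sum_congr rfl fun t _ => ?_
  rcases (condProb_nonneg P' T S t s).eq_or_lt with h0 | h0
  · rw [← h0, zero_mul]
  · rw [sum_condProb_eq_one, mul_one]
    rw [← condProb_mul_prob]
    exact mul_pos h0 hs

theorem condProb_output_pos
    (hV : ∀ u s v, prob P' (fun ω => (U ω, S ω, V ω)) (u, s, v) =
      prob P' (fun ω => (U ω, S ω)) (u, s) * W u s v)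
    (hTUSV : IsMarkovChain P' T (fun ω => (U ω, S ω)) V) (f : 𝒱 → 𝒱') {s : 𝒮} {t : 𝒯} {u : 𝒰} {v : 𝒱}
    (h0 : 0 < condProb P' T S t s * condProb P' U (fun ω => (T ω, S ω)) u (t, s) * W u s v) :
    0 < condProb P' T (fun ω => f (V ω)) t (f v) := by
  have hs : 0 < prob P' S s := by
    refine lt_of_le_of_ne (prob_nonneg _ _ _) fun h => h0.ne' ?_
    rw [condProb, ← h, div_zero, zero_mul, zero_mul]
  have h1 := mul_pos hs h0
  rw [← prob_state_channel hV hTUSV] at h1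
  exact condProb_pos P' (h1.trans_le
    (prob_le_prob_comp P' _ (fun w => (w.2.1, f w.2.2.2)) (s, t, u, v)))

/-- The moment of order `l` of `Pr[Z = z | X = x] / Pr[Z = z | f(Y) = f(y)]`. -/
noncomputable def sourceMoment {𝒳 𝒴 𝒴' 𝒵 : Type*} [Fintype 𝒳] [Fintype 𝒴] [Fintype 𝒵]
    (P : PMF Ω) (X : Ω → 𝒳) (Y : Ω → 𝒴) (Z : Ω → 𝒵) (f : 𝒴 → 𝒴') (l : ℝ) : ℝ :=
  ∑ w : 𝒳 × 𝒴 × 𝒵, prob P (fun ω => (X ω, Y ω)) (w.1, w.2.1) * condProb P Z X w.2.2 w.1 *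
    (condProb P Z X w.2.2 w.1 / condProb P Z (fun ω => f (Y ω)) w.2.2 (f w.2.1)) ^ l

/-- The moment of order `l` of `Pr[T = t | S = s] / Pr[T = t | f(V) = f(v)]`, given `S = s`. -/
noncomputable def channelMoment (P' : PMF Ω') (S : Ω' → 𝒮) (T : Ω' → 𝒯) (U : Ω' → 𝒰) (V : Ω' → 𝒱)
    (W : 𝒰 → 𝒮 → 𝒱 → ℝ) (f : 𝒱 → 𝒱') (l : ℝ) (s : 𝒮) : ℝ :=
  ∑ r : 𝒯 × 𝒰 × 𝒱, condProb P' T S r.1 s *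
    condProb P' U (fun ω => (T ω, S ω)) r.2.1 (r.1, s) * W r.2.1 s r.2.2 *
    (condProb P' T S r.1 s / condProb P' T (fun ω => f (V ω)) r.1 (f r.2.2)) ^ l

theorem channelMoment_pos (hW : ∀ u s v, 0 ≤ W u s v) (hW1 : ∀ u s, ∑ v, W u s v = 1)
    (hV : ∀ u s v, prob P' (fun ω => (U ω, S ω, V ω)) (u, s, v) =
      prob P' (fun ω => (U ω, S ω)) (u, s) * W u s v)
    (hTUSV : IsMarkovChain P' T (fun ω => (U ω, S ω)) V) (f : 𝒱 → 𝒱') (l : ℝ) {s : 𝒮}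
    (hs : 0 < prob P' S s) : 0 < channelMoment P' S T U V W f l s :=
  sum_mul_rpow_pos
    (fun _ => mul_nonneg (mul_nonneg (condProb_nonneg _ _ _ _ _) (condProb_nonneg _ _ _ _ _))
      (hW _ _ _))
    (sum_condProb_channel hW1 hs)
    (fun _ hr => div_pos
      (lt_of_le_of_ne (condProb_nonneg _ _ _ _ _) fun h => hr.ne' (by rw [← h]; ring))
      (condProb_output_pos hV hTUSV f hr))
    (fun _ => div_nonneg (condProb_nonneg _ _ _ _ _) (condProb_nonneg _ _ _ _ _)) l

/-- The expression vanishes at `l = 0`, with derivative `log 2` times the gap between the two sides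
of `hrate`. The logarithm is taken separately for each state letter, since the state word is
controlled only through its frequencies. -/
theorem exists_rate_exponent {𝒳 𝒴 𝒴' 𝒵 : Type*} [Fintype 𝒳] [Fintype 𝒴] [Fintype 𝒴'] [Fintype 𝒵]
    {X : Ω → 𝒳} {Y : Ω → 𝒴} {Z : Ω → 𝒵} (hYXZ : IsMarkovChain P Y X Z) (fY : 𝒴 → 𝒴')
    (hW : ∀ u s v, 0 ≤ W u s v) (hW1 : ∀ u s, ∑ v, W u s v = 1)
    (hV : ∀ u s v, prob P' (fun ω => (U ω, S ω, V ω)) (u, s, v) =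
      prob P' (fun ω => (U ω, S ω)) (u, s) * W u s v)
    (hTUSV : IsMarkovChain P' T (fun ω => (U ω, S ω)) V) (fV : 𝒱 → 𝒱') (κ : ℝ)
    (hrate : condMutualInfo P X Z (fun ω => fY (Y ω)) <
      κ * (mutualInfo P' T (fun ω => fV (V ω)) - mutualInfo P' T S)) :
    ∃ l : ℝ, 0 < l ∧ l ≤ 1 ∧
      Real.log (sourceMoment P X Y Z fY l) +
        κ * ∑ s, prob P' S s * Real.log (channelMoment P' S T U V W fV l s) < 0 := by
  unfold sourceMoment channelMoment
  have hlog : 0 < Real.log 2 := Real.log_pos one_lt_two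
  have hsrc := hasDerivAt_log_sum_rpow
    (fun w : 𝒳 × 𝒴 × 𝒵 => prob P (fun ω => (X ω, Y ω)) (w.1, w.2.1) * condProb P Z X w.2.2 w.1)
    (fun w => condProb P Z X w.2.2 w.1 / condProb P Z (fun ω => fY (Y ω)) w.2.2 (fY w.2.1))
    (fun w => mul_nonneg (prob_nonneg _ _ _) (condProb_nonneg _ _ _ _ _))
    (sum_prob_mul_condProb hYXZ)
    (fun w hw => div_pos (pos_of_mul_pos_right hw (prob_nonneg _ _ _))
      (condProb_side_pos hYXZ fY hw))
  have hρ0 : ∀ s (r : 𝒯 × 𝒰 × 𝒱), 0 ≤ condProb P' T S r.1 s *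
      condProb P' U (fun ω => (T ω, S ω)) r.2.1 (r.1, s) * W r.2.1 s r.2.2 := fun s r =>
    mul_nonneg (mul_nonneg (condProb_nonneg _ _ _ _ _) (condProb_nonneg _ _ _ _ _)) (hW _ _ _)
  have hch : HasDerivAt (fun l : ℝ => ∑ s, prob P' S s * Real.log (∑ r : 𝒯 × 𝒰 × 𝒱,
        condProb P' T S r.1 s *
        condProb P' U (fun ω => (T ω, S ω)) r.2.1 (r.1, s) * W r.2.1 s r.2.2 *
        (condProb P' T S r.1 s / condProb P' T (fun ω => fV (V ω)) r.1 (fV r.2.2)) ^ l))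
      (∑ s, prob P' S s * ∑ r : 𝒯 × 𝒰 × 𝒱, condProb P' T S r.1 s *
        condProb P' U (fun ω => (T ω, S ω)) r.2.1 (r.1, s) * W r.2.1 s r.2.2 *
        Real.log (condProb P' T S r.1 s / condProb P' T (fun ω => fV (V ω)) r.1 (fV r.2.2))) 0 := by
    refine HasDerivAt.fun_sum fun s _ => ?_
    rcases (prob_nonneg P' S s).eq_or_lt with h0 | h0
    · simpa [← h0] using hasDerivAt_const (0 : ℝ) (0 : ℝ)
    · exact (hasDerivAt_log_sum_rpow _ _ (hρ0 s) (sum_condProb_channel hW1 h0) fun r hr =>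
        div_pos (lt_of_le_of_ne (condProb_nonneg _ _ _ _ _) fun h => hr.ne' (by rw [← h]; ring))
          (condProb_output_pos hV hTUSV fV hr)).const_mul _
  refine exists_neg_of_hasDerivAt (hsrc.fun_add (hch.const_mul κ)) ?_ ?_
  · have h1 : ∀ s, prob P' S s * Real.log (∑ r : 𝒯 × 𝒰 × 𝒱, condProb P' T S r.1 s *
        condProb P' U (fun ω => (T ω, S ω)) r.2.1 (r.1, s) * W r.2.1 s r.2.2) = 0 := by
      intro s
      rcases (prob_nonneg P' S s).eq_or_lt with h0 | h0
      · rw [← h0, zero_mul]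
      · rw [sum_condProb_channel hW1 h0, Real.log_one, mul_zero]
    simp only [Real.rpow_zero, mul_one, sum_prob_mul_condProb hYXZ, Real.log_one, h1,
      Finset.sum_const_zero, mul_zero, add_zero]
  · rw [← condMutualInfo_mul_log_two_joint hYXZ fY]
    have h2 : ∑ s, prob P' S s * ∑ r : 𝒯 × 𝒰 × 𝒱, condProb P' T S r.1 s *
        condProb P' U (fun ω => (T ω, S ω)) r.2.1 (r.1, s) * W r.2.1 s r.2.2 *
        Real.log (condProb P' T S r.1 s / condProb P' T (fun ω => fV (V ω)) r.1 (fV r.2.2)) =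
        (mutualInfo P' T S - mutualInfo P' T (fun ω => fV (V ω))) * Real.log 2 := by
      rw [mutualInfo_sub_mul_log_two S T U V fV, Fintype.sum_prod_type]
      refine Finset.sum_congr rfl fun s _ => ?_
      rw [Finset.mul_sum]
      refine Finset.sum_congr rfl fun r _ => ?_
      rw [prob_state_channel hV hTUSV, mul_assoc (prob P' S s)]
    rw [h2]
    have := mul_lt_mul_of_pos_right hrate hlog
    linarith

end Exponents

/-! ### Success mass for typical state words -/

section Memoryless

variable {Ω Ω' : Type*} {P : PMF Ω} {P' : PMF Ω'}
  {𝒳 𝒴 𝒴' 𝒵 𝒮 𝒯 𝒰 𝒱 𝒱' : Type*} [Fintype 𝒳] [Fintype 𝒴] [Fintype 𝒴'] [Fintype 𝒵] [Fintype 𝒮]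
  [Fintype 𝒯] [Fintype 𝒰] [Fintype 𝒱] [Fintype 𝒱'] {m n : ℕ}
  {X : Ω → 𝒳} {Y : Ω → 𝒴} {Z : Ω → 𝒵} {S : Ω' → 𝒮} {T : Ω' → 𝒯} {U : Ω' → 𝒰} {V : Ω' → 𝒱}
  {W : 𝒰 → 𝒮 → 𝒱 → ℝ}

theorem sum_prob_mul_condProb_right (x : 𝒳) :
    ∑ yz : 𝒴 × 𝒵, prob P (fun ω => (X ω, Y ω)) (x, yz.1) * condProb P Z X yz.2 x =
      prob P X x := by
  rw [Fintype.sum_prod_type]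
  simp_rw [← Finset.mul_sum]
  rw [← Finset.sum_mul]
  have h1 : ∑ y, prob P (fun ω => (X ω, Y ω)) (x, y) = prob P X x := by
    rw [← sum_prob_pair P Y X x]
    exact Finset.sum_congr rfl fun y _ => prob_swap P Y X y x
  rw [h1]
  rcases (prob_nonneg P X x).eq_or_lt with h0 | h0
  · rw [← h0, zero_mul]
  · rw [sum_condProb_eq_one P Z X h0, mul_one]

/-- The two subtracted exponentials bound the losses from mismatched selection and from excess
distortion; the first term is the probability of a typical state. -/
theorem le_success_mass_typical (hYXZ : IsMarkovChain P Y X Z) (fY : 𝒴 → 𝒴')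
    (hW : ∀ u s v, 0 ≤ W u s v) (hW1 : ∀ u s, ∑ v, W u s v = 1)
    (hV : ∀ u s v, prob P' (fun ω => (U ω, S ω, V ω)) (u, s, v) =
      prob P' (fun ω => (U ω, S ω)) (u, s) * W u s v)
    (hTUSV : IsMarkovChain P' T (fun ω => (U ω, S ω)) V) (fV : 𝒱 → 𝒱') {κ : ℝ} (hm : 0 < m)
    (hmn : (m : ℝ) = κ * n) {q : (Fin n → 𝒳) → (Fin m → 𝒮) → ℝ} (hq : ∀ x s, 0 ≤ q x s)
    (hq1 : ∀ x, ∑ s, q x s ≤ 1) (d : 𝒳 → 𝒴 → 𝒵 → ℝ) (D η l l' : ℝ) (hl0 : 0 ≤ l) (hl1 : l ≤ 1)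
    (hl' : 0 ≤ l') :
    (∑ x : Fin n → 𝒳, ∑ s : Fin m → 𝒮,
          (∏ i, prob P X (x i)) * (typicalSet η m (P'.map S)).indicator (q x) s) -
        Real.exp (n * (Real.log (sourceMoment P X Y Z fY l) +
          κ * ∑ s, prob P' S s * Real.log (channelMoment P' S T U V W fV l s) +
          κ * (η * ∑ s, prob P' S s * |Real.log (channelMoment P' S T U V W fV l s)|))) -
        Real.exp (n * Real.log (∑ w : 𝒳 × 𝒴 × 𝒵, prob P (fun ω => (X ω, Y ω)) (w.1, w.2.1) *
          condProb P Z X w.2.2 w.1 * Real.exp (d w.1 w.2.1 w.2.2 - D) ^ l')) ≤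
      ∑ x, ∑ s, ∑ c : (Fin n → 𝒵) × (Fin m → 𝒯), ∑ u : Fin m → 𝒰, ∑ y : Fin n → 𝒴,
        ∑ v : Fin m → 𝒱,
          (∏ i, prob P (fun ω => (X ω, Y ω)) (x i, y i)) * q x s * (∏ j, W (u j) (s j) (v j)) *
            (∏ j, condProb P' U (fun ω => (T ω, S ω)) (u j) (c.2 j, s j)) *
            truthValue (∑ i, d (x i) (y i) (c.1 i) ≤ n * D) *
            ((∏ i, condProb P Z X (c.1 i) (x i)) * (∏ j, condProb P' T S (c.2 j) (s j)) *
                ((∏ i, condProb P Z (fun ω => fY (Y ω)) (c.1 i) (fY (y i))) *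
                  ∏ j, condProb P' T (fun ω => fV (V ω)) (c.2 j) (fV (v j))) /
              ((∏ i, condProb P Z X (c.1 i) (x i)) * (∏ j, condProb P' T S (c.2 j) (s j)) +
                (∏ i, condProb P Z (fun ω => fY (Y ω)) (c.1 i) (fY (y i))) *
                  ∏ j, condProb P' T (fun ω => fV (V ω)) (c.2 j) (fV (v j)))) := by
  refine le_trans ?_ (le_success_mass (fun x y => prob P (fun ω => (X ω, Y ω)) (x, y)) W
    (fun x z => condProb P Z X z x) (fun s t => condProb P' T S t s)
    (fun s t u => condProb P' U (fun ω => (T ω, S ω)) u (t, s))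
    (fun y z => condProb P Z (fun ω => fY (Y ω)) z (fY y))
    (fun v t => condProb P' T (fun ω => fV (V ω)) t (fV v))
    (fun _ _ => prob_nonneg _ _ _) hW (fun _ _ => condProb_nonneg _ _ _ _ _)
    (fun _ _ => condProb_nonneg _ _ _ _ _) (fun _ _ _ => condProb_nonneg _ _ _ _ _)
    (fun _ _ => condProb_nonneg _ _ _ _ _) (fun _ _ => condProb_nonneg _ _ _ _ _)
    (fun _ _ _ h => condProb_side_pos hYXZ fY h)
    (fun _ _ _ _ h => condProb_output_pos hV hTUSV fV h)
    q hq (typicalSet η m (P'.map S)) d D l l' hl0 hl1 hl')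
  -- An inequality suffices, and it also covers `a = 0`, where `Real.log 0 = 0`.
  have hpow : ∀ a : ℝ, 0 ≤ a → a ^ n ≤ Real.exp (n * Real.log a) := fun a ha => by
    rw [Real.exp_nat_mul]
    exact pow_le_pow_left₀ ha (Real.le_exp_log a) n
  have hone : ∀ s ∈ typicalSet η m (P'.map S), ∏ j : Fin m, ∑ r : 𝒯 × 𝒰 × 𝒱,
      condProb P' T S r.1 (s j) * condProb P' U (fun ω => (T ω, S ω)) r.2.1 (r.1, s j) *
        W r.2.1 (s j) r.2.2 = 1 := fun s hs =>
    Finset.prod_eq_one fun j _ => sum_condProb_channel hW1 (pos_of_mem_typicalSet hs j)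
  simp only [Finset.sum_sub_distrib, sum_prob_mul_condProb_right]
  refine sub_le_sub (sub_le_sub (le_of_eq ?_) ?_) ?_
  · refine Finset.sum_congr rfl fun x _ => Finset.sum_congr rfl fun s _ => ?_
    by_cases hs : s ∈ typicalSet η m (P'.map S)
    · rw [hone s hs, mul_one, mul_comm]
    · rw [Set.indicator_of_notMem hs]; ring
  · have hb := fun s (hs : s ∈ typicalSet η m (P'.map S)) =>
      prod_le_exp_of_mem_typicalSet hm hs (channelMoment P' S T U V W fV l) fun a ha =>
        channelMoment_pos hW hW1 hV hTUSV fV l ha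
    have ha0 : ∀ x, 0 ≤ ∑ yz : 𝒴 × 𝒵, prob P (fun ω => (X ω, Y ω)) (x, yz.1) *
        condProb P Z X yz.2 x *
        (condProb P Z X yz.2 x / condProb P Z (fun ω => fY (Y ω)) yz.2 (fY yz.1)) ^ l := fun x =>
      Finset.sum_nonneg fun yz _ => mul_nonneg
        (mul_nonneg (prob_nonneg _ _ _) (condProb_nonneg _ _ _ _ _))
        (Real.rpow_nonneg (div_nonneg (condProb_nonneg _ _ _ _ _) (condProb_nonneg _ _ _ _ _)) _)
    refine (sum_indicator_mul_prod_le hq hq1 _ ha0 (Real.exp_pos _).le hb).trans ?_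
    rw [← Fintype.sum_prod_type (f := fun w : 𝒳 × 𝒴 × 𝒵 =>
      prob P (fun ω => (X ω, Y ω)) (w.1, w.2.1) * condProb P Z X w.2.2 w.1 *
        (condProb P Z X w.2.2 w.1 / condProb P Z (fun ω => fY (Y ω)) w.2.2 (fY w.2.1)) ^ l)]
    have h1 := hpow (sourceMoment P X Y Z fY l) (by
      rw [sourceMoment, Fintype.sum_prod_type]
      exact Finset.sum_nonneg fun x _ => ha0 x)
    change sourceMoment P X Y Z fY l ^ n * _ ≤ _
    refine (mul_le_mul_of_nonneg_right h1 (Real.exp_pos _).le).trans_eq ?_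
    rw [← Real.exp_add, hmn]
    congr 1
    simp only [prob]
    ring
  · have ha0 : ∀ x, 0 ≤ ∑ yz : 𝒴 × 𝒵, prob P (fun ω => (X ω, Y ω)) (x, yz.1) *
        condProb P Z X yz.2 x * Real.exp (d x yz.1 yz.2 - D) ^ l' := fun x =>
      Finset.sum_nonneg fun yz _ => mul_nonneg
        (mul_nonneg (prob_nonneg _ _ _) (condProb_nonneg _ _ _ _ _))
        (Real.rpow_nonneg (Real.exp_pos _).le _)
    refine (sum_indicator_mul_prod_le hq hq1 _ ha0 (b := fun s => ∑ r : 𝒯 × 𝒰 × 𝒱,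
      condProb P' T S r.1 s * condProb P' U (fun ω => (T ω, S ω)) r.2.1 (r.1, s) *
        W r.2.1 s r.2.2) zero_le_one fun s hs => (hone s hs).le).trans ?_
    rw [mul_one, Fintype.sum_prod_type]
    exact hpow _ (Finset.sum_nonneg fun x _ => ha0 x)

end Memoryless

/-! ### Codes for memoryless sources and channels -/

section Assembly

variable {m n : ℕ}

theorem sum_pair_words_le_one {α β : Type*} [Fintype α] [Fintype β] {f : Fin n → α → ℝ}
    {g : Fin m → β → ℝ} (hf : ∀ i a, 0 ≤ f i a) (hg : ∀ j b, 0 ≤ g j b)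
    (hf1 : ∀ i, ∑ a, f i a ≤ 1) (hg1 : ∀ j, ∑ b, g j b ≤ 1) :
    ∑ c : (Fin n → α) × (Fin m → β), (∏ i, f i (c.1 i)) * ∏ j, g j (c.2 j) ≤ 1 := by
  simp only [Fintype.sum_prod_type]
  simp_rw [← Finset.mul_sum, ← Finset.sum_mul]
  rw [sum_word_prod, sum_word_prod]
  exact mul_le_one₀ (Finset.prod_le_one (fun i _ => Finset.sum_nonneg fun a _ => hf i a)
    fun i _ => hf1 i) (Finset.prod_nonneg fun j _ => Finset.sum_nonneg fun b _ => hg j b)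
    (Finset.prod_le_one (fun j _ => Finset.sum_nonneg fun b _ => hg j b) fun j _ => hg1 j)

theorem sum_comm_four {ι α β γ δ : Type*} [Fintype ι] [Fintype α] [Fintype β] [Fintype γ]
    [Fintype δ] (F : ι → α → β → γ → δ → ℝ) :
    ∑ k, ∑ a, ∑ b, ∑ c, ∑ d, F k a b c d = ∑ a, ∑ b, ∑ c, ∑ d, ∑ k, F k a b c d := by
  refine Finset.sum_comm.trans (Finset.sum_congr rfl fun a _ => ?_)
  refine Finset.sum_comm.trans (Finset.sum_congr rfl fun b _ => ?_)
  exact Finset.sum_comm.trans (Finset.sum_congr rfl fun c _ => Finset.sum_comm)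

theorem sum_comm_six {ι α β γ δ ε ζ : Type*} [Fintype ι] [Fintype α] [Fintype β] [Fintype γ]
    [Fintype δ] [Fintype ε] [Fintype ζ] (F : ι → α → β → γ → δ → ε → ζ → ℝ) :
    ∑ k, ∑ a, ∑ b, ∑ c, ∑ d, ∑ e, ∑ f, F k a b c d e f =
      ∑ a, ∑ b, ∑ c, ∑ d, ∑ e, ∑ f, ∑ k, F k a b c d e f := by
  refine Finset.sum_comm.trans (Finset.sum_congr rfl fun a _ => ?_)
  refine Finset.sum_comm.trans (Finset.sum_congr rfl fun b _ => ?_)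
  exact sum_comm_four _

/-- The one-shot code for memoryless sources and channels, with the selection weights
`zx`, `ts`, `uts` of the encoder and the posterior weights `zy k`, `tv k` of the decoders. -/
theorem exists_memoryless_code {K : ℕ} {𝒳 𝒮 𝒰 𝒵 𝒯 : Type*} {𝒱 𝒴 : Fin K → Type*}
    [Fintype 𝒳] [Fintype 𝒮] [Fintype 𝒰] [Fintype 𝒵] [Fintype 𝒯] [∀ k, Fintype (𝒱 k)]
    [∀ k, Fintype (𝒴 k)] [Nonempty 𝒰] [Nonempty 𝒵] [Nonempty 𝒯]
    (p : 𝒳 → (∀ k, 𝒴 k) → ℝ) (q : (Fin n → 𝒳) → (Fin m → 𝒮) → ℝ) (W : 𝒰 → 𝒮 → (∀ k, 𝒱 k) → ℝ)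
    (zx : 𝒳 → 𝒵 → ℝ) (ts : 𝒮 → 𝒯 → ℝ) (uts : 𝒮 → 𝒯 → 𝒰 → ℝ) (zy : ∀ k, 𝒴 k → 𝒵 → ℝ)
    (tv : ∀ k, 𝒱 k → 𝒯 → ℝ) (ok : Fin K → (Fin n → 𝒳) → (Fin n → ∀ k, 𝒴 k) → (Fin n → 𝒵) → Prop)
    (hp : ∀ x y, 0 ≤ p x y) (hq : ∀ x s, 0 ≤ q x s) (hW : ∀ u s v, 0 ≤ W u s v)
    (hzx : ∀ x z, 0 ≤ zx x z) (hzx1 : ∀ x, ∑ z, zx x z ≤ 1)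
    (hts : ∀ s t, 0 ≤ ts s t) (hts1 : ∀ s, ∑ t, ts s t ≤ 1)
    (huts : ∀ s t u, 0 ≤ uts s t u) (huts1 : ∀ s t, ∑ u, uts s t u ≤ 1)
    (hzy : ∀ k y z, 0 ≤ zy k y z) (hzy1 : ∀ k y, ∑ z, zy k y z ≤ 1)
    (htv : ∀ k v t, 0 ≤ tv k v t) (htv1 : ∀ k v, ∑ t, tv k v t ≤ 1) :
    ∃ (enc : (Fin n → 𝒳) → (Fin m → 𝒮) → (Fin m → 𝒰))
      (dec : ∀ k, (Fin m → 𝒱 k) → (Fin n → 𝒴 k) → (Fin n → 𝒵)),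
      ∑ k, ∑ x, ∑ s, ∑ c : (Fin n → 𝒵) × (Fin m → 𝒯), ∑ u : Fin m → 𝒰,
        ∑ y : Fin n → ∀ k, 𝒴 k, ∑ v : Fin m → ∀ k, 𝒱 k,
          (∏ i, p (x i) (y i)) * q x s * (∏ j, W (u j) (s j) (v j)) *
            (∏ j, uts (s j) (c.2 j) (u j)) * truthValue (ok k x y c.1) *
            ((∏ i, zx (x i) (c.1 i)) * (∏ j, ts (s j) (c.2 j)) *
                ((∏ i, zy k (y i k) (c.1 i)) * ∏ j, tv k (v j k) (c.2 j)) /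
              ((∏ i, zx (x i) (c.1 i)) * (∏ j, ts (s j) (c.2 j)) +
                (∏ i, zy k (y i k) (c.1 i)) * ∏ j, tv k (v j k) (c.2 j))) ≤
        ∑ k, ∑ x, ∑ s, ∑ y : Fin n → ∀ k, 𝒴 k, ∑ v : Fin m → ∀ k, 𝒱 k,
          (∏ i, p (x i) (y i)) * q x s * (∏ j, W (enc x s j) (s j) (v j)) *
            truthValue (ok k x y (dec k (fun j => v j k) fun i => y i k)) := by
  have hP : ∀ (x : Fin n → 𝒳) (s : Fin m → 𝒮) (c : (Fin n → 𝒵) × (Fin m → 𝒯)),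
      0 ≤ (∏ i, zx (x i) (c.1 i)) * ∏ j, ts (s j) (c.2 j) := fun x s c =>
    mul_nonneg (Finset.prod_nonneg fun _ _ => hzx _ _) (Finset.prod_nonneg fun _ _ => hts _ _)
  have hP1 : ∀ (x : Fin n → 𝒳) (s : Fin m → 𝒮), ∑ c : (Fin n → 𝒵) × (Fin m → 𝒯),
      (∏ i, zx (x i) (c.1 i)) * ∏ j, ts (s j) (c.2 j) ≤ 1 := fun x s =>
    sum_pair_words_le_one (f := fun i z => zx (x i) z) (g := fun j t => ts (s j) t)
      (fun _ _ => hzx _ _) (fun _ _ => hts _ _) (fun _ => hzx1 _) fun _ => hts1 _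
  have hR : ∀ k (v : Fin m → 𝒱 k) (y : Fin n → 𝒴 k) (c : (Fin n → 𝒵) × (Fin m → 𝒯)),
      0 ≤ (∏ i, zy k (y i) (c.1 i)) * ∏ j, tv k (v j) (c.2 j) := fun k v y c =>
    mul_nonneg (Finset.prod_nonneg fun _ _ => hzy _ _ _) (Finset.prod_nonneg fun _ _ => htv _ _ _)
  have hR1 : ∀ k (v : Fin m → 𝒱 k) (y : Fin n → 𝒴 k), ∑ c : (Fin n → 𝒵) × (Fin m → 𝒯),
      (∏ i, zy k (y i) (c.1 i)) * ∏ j, tv k (v j) (c.2 j) ≤ 1 := fun k v y =>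
    sum_pair_words_le_one (f := fun i z => zy k (y i) z) (g := fun j t => tv k (v j) t)
      (fun _ _ => hzy _ _ _) (fun _ _ => htv _ _ _) (fun _ => hzy1 _ _) fun _ => htv1 _ _
  have hβ : ∀ (s : Fin m → 𝒮) (c : (Fin n → 𝒵) × (Fin m → 𝒯)) (u : Fin m → 𝒰),
      0 ≤ ∏ j, uts (s j) (c.2 j) (u j) := fun s c u => Finset.prod_nonneg fun _ _ => huts _ _ _
  have hβ1 : ∀ (s : Fin m → 𝒮) (c : (Fin n → 𝒵) × (Fin m → 𝒯)),
      ∑ u : Fin m → 𝒰, ∏ j, uts (s j) (c.2 j) (u j) ≤ 1 := fun s c => by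
    rw [sum_word_prod fun j u => uts (s j) (c.2 j) u]
    exact Finset.prod_le_one (fun _ _ => Finset.sum_nonneg fun _ _ => huts _ _ _)
      fun _ _ => huts1 _ _
  obtain ⟨enc, dec, h⟩ := exists_oneShot_code (K := K) (𝒳 := Fin n → 𝒳) (𝒴 := Fin n → ∀ k, 𝒴 k)
    (𝒮 := Fin m → 𝒮) (𝒰 := Fin m → 𝒰) (𝒱 := Fin m → ∀ k, 𝒱 k)
    (𝒞 := (Fin n → 𝒵) × (Fin m → 𝒯)) (𝒴' := fun k => Fin n → 𝒴 k) (𝒱' := fun k => Fin m → 𝒱 k)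
    (fun k y i => y i k) (fun k v j => v j k) (fun x y => ∏ i, p (x i) (y i)) q
    (fun u s v => ∏ j, W (u j) (s j) (v j))
    (fun x s c => (∏ i, zx (x i) (c.1 i)) * ∏ j, ts (s j) (c.2 j))
    (fun s c u => ∏ j, uts (s j) (c.2 j) (u j))
    (fun k v y c => (∏ i, zy k (y i) (c.1 i)) * ∏ j, tv k (v j) (c.2 j))
    (fun k x y c => ok k x y c.1) (fun _ _ => Finset.prod_nonneg fun _ _ => hp _ _) hq
    (fun _ _ _ => Finset.prod_nonneg fun _ _ => hW _ _ _) hP hP1 hβ hβ1 hR hR1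
  -- The decoded word over `𝒯` only helps to identify the pair; the reconstruction needs `z` alone.
  refine ⟨enc, fun k v y => (dec k v y).1, ?_⟩
  exact (sum_comm_six _).trans_le (h.trans_eq (sum_comm_four _).symm)

theorem sum_source_channel_eq_one {𝒳 𝒴 𝒮 𝒰 𝒱 : Type*} [Fintype 𝒳] [Fintype 𝒴] [Fintype 𝒮]
    [Fintype 𝒱] {p : 𝒳 → 𝒴 → ℝ} (hp1 : ∑ x, ∑ y, p x y = 1) {q : (Fin n → 𝒳) → (Fin m → 𝒮) → ℝ}
    (hq1 : ∀ x, ∑ s, q x s = 1) {W : 𝒰 → 𝒮 → 𝒱 → ℝ} (hW1 : ∀ u s, ∑ v, W u s v = 1)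
    (enc : (Fin n → 𝒳) → (Fin m → 𝒮) → (Fin m → 𝒰)) :
    ∑ x : Fin n → 𝒳, ∑ s : Fin m → 𝒮, ∑ y : Fin n → 𝒴, ∑ v : Fin m → 𝒱,
      (∏ i, p (x i) (y i)) * q x s * ∏ j, W (enc x s j) (s j) (v j) = 1 := by
  have hv : ∀ x s, ∑ v : Fin m → 𝒱, ∏ j, W (enc x s j) (s j) (v j) = 1 := fun x s => by
    rw [sum_word_prod fun j v => W (enc x s j) (s j) v]
    exact Finset.prod_eq_one fun j _ => hW1 _ _
  simp_rw [← Finset.mul_sum, hv, mul_one, ← Finset.sum_mul, ← Finset.mul_sum, hq1, mul_one]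
  have hy : ∀ x : Fin n → 𝒳, ∑ y : Fin n → 𝒴, ∏ i, p (x i) (y i) = ∏ i, ∑ y, p (x i) y :=
    fun x => sum_word_prod fun i y => p (x i) y
  simp_rw [hy]
  rw [sum_word_prod fun _ x => ∑ y, p x y]
  exact Finset.prod_eq_one fun _ _ => hp1

theorem blockDistortion_le {𝒳 𝒳h : Type*} (hn : 0 < n) {d : 𝒳 → 𝒳h → ℝ≥0} {x : Fin n → 𝒳}
    {xh : Fin n → 𝒳h} {D : ℝ} (h : ∑ i, (d (x i) (xh i) : ℝ) ≤ n * D) :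
    blockDistortion d x xh ≤ D := by
  have hn' : (0 : ℝ) < n := Nat.cast_pos.2 hn
  rw [blockDistortion, one_div, inv_mul_le_iff₀ hn']
  exact h

end Assembly

end WZBC

/-! ### The coding theorem -/

open WZBC in
theorem theorem1 {K : ℕ} {𝒳 𝒮 𝒰 𝒵 𝒯 Ω Ω' : Type*} {𝒱 𝒴 𝒳hat : Fin K → Type*}
    [Fintype 𝒳] [Fintype 𝒮] [Fintype 𝒰] [Fintype 𝒵] [Fintype 𝒯]
    [∀ k, Fintype (𝒱 k)] [∀ k, Fintype (𝒴 k)]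
    -- the source with its side informations, the state law, the channel, the distortions
    (pXY : PMF (𝒳 × (∀ k, 𝒴 k))) (pS : PMF 𝒮) (W : 𝒰 → 𝒮 → PMF (∀ k, 𝒱 k))
    (d : ∀ k, 𝒳 → 𝒳hat k → ℝ≥0)
    (κ : ℚ) (hκ : 0 < κ) (D : Fin K → ℝ)
    -- the source random variables `X, (Y_1, …, Y_K), Z`
    (P : PMF Ω) (X : Ω → 𝒳) (Y : Ω → (∀ k, 𝒴 k)) (Z : Ω → 𝒵)
    (hXY : P.map (fun ω => (X ω, Y ω)) = pXY)
    (hYXZ : WZBC.IsMarkovChain P Y X Z)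
    -- the channel random variables `S, T, U, (V_1, …, V_K)`
    (P' : PMF Ω') (S : Ω' → 𝒮) (T : Ω' → 𝒯) (U : Ω' → 𝒰) (V : Ω' → (∀ k, 𝒱 k))
    (hS : P'.map S = pS)
    (hV : ∀ u s v, WZBC.prob P' (fun ω => (U ω, S ω, V ω)) (u, s, v) =
      WZBC.prob P' (fun ω => (U ω, S ω)) (u, s) * (W u s v).toReal)
    (hTUSV : WZBC.IsMarkovChain P' T (fun ω => (U ω, S ω)) V)
    -- the reconstruction functions
    (g : ∀ k, 𝒵 → 𝒴 k → 𝒳hat k)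
    (hrate : ∀ k, WZBC.condMutualInfo P X Z (fun ω => Y ω k) <
      (κ : ℝ) * (WZBC.mutualInfo P' T (fun ω => V ω k) - WZBC.mutualInfo P' T S))
    (hdist : ∀ k, ∑ x, ∑ y, ∑ z, WZBC.prob P (fun ω => (X ω, Y ω k, Z ω)) (x, y, z) *
      (d k x (g k z y) : ℝ) ≤ D k) :
    ∃ η : ℝ, 0 < η ∧ ∀ Q : WZBC.StateModel 𝒳 𝒮, WZBC.StateTypical pXY pS Q κ η →
      WZBC.Achievable pXY W Q d κ D := by
  subst hXY hS
  obtain ⟨ω₀, -⟩ := P.support_nonempty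
  obtain ⟨ω₁, -⟩ := P'.support_nonempty
  have : Nonempty 𝒵 := ⟨Z ω₀⟩
  have : Nonempty 𝒯 := ⟨T ω₁⟩
  have : Nonempty 𝒰 := ⟨U ω₁⟩
  have hW0 : ∀ u s v, 0 ≤ (W u s v).toReal := fun _ _ _ => ENNReal.toReal_nonneg
  have hW1 : ∀ u s, ∑ v, (W u s v).toReal = 1 := fun u s => sum_toReal_pmf (W u s)
  choose l hl0 hl1 hl using fun k => exists_rate_exponent hYXZ (fun y => y k) hW0 hW1 hV hTUSV
    (fun v => v k) (κ : ℝ) (hrate k)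
  -- Each exponent is continuous in `η` and negative at `η = 0`; as there are finitely many
  -- receivers, one `η` serves all, chosen before the state model.
  have hη : ∀ᶠ η in nhdsWithin (0 : ℝ) (Set.Ioi 0), 0 < η ∧ ∀ k,
      Real.log (sourceMoment P X Y Z (fun y => y k) (l k)) +
        κ * ∑ s, prob P' S s * Real.log (channelMoment P' S T U V
          (fun u s v => (W u s v).toReal) (fun v => v k) (l k) s) +
        κ * (η * ∑ s, prob P' S s * |Real.log (channelMoment P' S T U V
          (fun u s v => (W u s v).toReal) (fun v => v k) (l k) s)|) < 0 := by
    refine eventually_mem_nhdsWithin.and (Filter.eventually_all.2 fun k => ?_)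
    refine Filter.Eventually.filter_mono nhdsWithin_le_nhds ?_
    refine ContinuousAt.eventually_lt (by fun_prop) continuousAt_const ?_
    simpa using hl k
  obtain ⟨η, hη0, hη⟩ := hη.exists
  refine ⟨η, hη0, fun Q hQ ε hε => ?_⟩
  have hD : ∀ k, ∑ w : 𝒳 × (∀ k, 𝒴 k) × 𝒵,
      prob P (fun ω => (X ω, Y ω)) (w.1, w.2.1) * condProb P Z X w.2.2 w.1 *
        (d k w.1 (g k w.2.2 (w.2.1 k)) : ℝ) ≤ D k := by
    intro k
    refine le_of_eq_of_le ?_ (hdist k)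
    have h := sum_prob_comp_mul P (fun ω => (X ω, Y ω, Z ω)) (fun w => (w.1, w.2.1 k, w.2.2))
      (fun w => (d k w.1 (g k w.2.2 w.2.1) : ℝ))
    simp only [← hYXZ.prob_eq_mul_condProb]
    rw [← h]
    simp only [Fintype.sum_prod_type]
  have hj0 : ∀ w : 𝒳 × (∀ k, 𝒴 k) × 𝒵,
      0 ≤ prob P (fun ω => (X ω, Y ω)) (w.1, w.2.1) * condProb P Z X w.2.2 w.1 := fun w =>
    mul_nonneg (prob_nonneg _ _ _) (condProb_nonneg _ _ _ _ _)
  have hD0 : ∀ k, 0 ≤ D k := fun k => le_trans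
    (Finset.sum_nonneg fun w _ => mul_nonneg (hj0 w) (NNReal.coe_nonneg _)) (hD k)
  -- The slack `ε / 2` turns the weak distortion bound into the strict one that a negative exponent
  -- requires.
  choose l' hl'0 hl'1 hl' using fun k => exists_distortion_exponent hj0
    (sum_prob_mul_condProb hYXZ) ((hD k).trans_lt (by linarith : D k < D k + ε / 2))
  -- The reproduction alphabets may be infinite, but only the finitely many values of the `g k` are
  -- used.
  obtain ⟨M, hM⟩ := (Set.finite_range fun r : (k : Fin K) × 𝒳 × 𝒵 × 𝒴 k =>
    (d r.1 r.2.1 (g r.1 r.2.2.1 r.2.2.2) : ℝ)).bddAbove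
  have hM' : ∀ k x z y, (d k x (g k z y) : ℝ) ≤ max M 0 := fun k x z y =>
    (hM ⟨⟨k, x, z, y⟩, rfl⟩).trans (le_max_left _ _)
  set M' := max M 0
  have hM0 : 0 ≤ M' := le_max_right _ _
  -- Chosen so that `M' * (K * δ) ≤ ε / 2`, the added ones keeping the denominator positive.
  -- Atypical states, mismatches and excess distortion each get `δ / 3`.
  set δ := ε / (2 * (M' + 1) * (K + 1)) with hδ
  have hδ0 : 0 < δ := by positivity
  obtain ⟨n₁, hn₁⟩ := hQ (δ / 3) (by positivity)
  obtain ⟨n₂, hn₂⟩ := exists_nat_forall_exp_mul_le hη (δ := δ / 3) (by positivity)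
  obtain ⟨n₃, hn₃⟩ := exists_nat_forall_exp_mul_le hl' (δ := δ / 3) (by positivity)
  refine ⟨max n₁ (max n₂ n₃), fun m n hm hn hmn => ?_⟩
  have hnpos : 0 < n := by omega
  have hmn' : (m : ℝ) = (κ : ℝ) * n := by
    have h : (m : ℚ) = κ * n := by
      rw [← hmn, div_mul_cancel₀]
      exact_mod_cast hnpos.ne'
    exact_mod_cast h
  have hq0 : ∀ x s, 0 ≤ (Q n m x s).toReal := fun _ _ => ENNReal.toReal_nonneg
  have hq1 : ∀ x, ∑ s, (Q n m x s).toReal = 1 := fun x => sum_toReal_pmf (Q n m x)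
  obtain ⟨enc, dec, hcode⟩ := exists_memoryless_code
    (fun x y => prob P (fun ω => (X ω, Y ω)) (x, y)) (fun x s => (Q n m x s).toReal)
    (fun u s v => (W u s v).toReal) (fun x z => condProb P Z X z x)
    (fun s t => condProb P' T S t s) (fun s t u => condProb P' U (fun ω => (T ω, S ω)) u (t, s))
    (fun k y z => condProb P Z (fun ω => Y ω k) z y)
    (fun k v t => condProb P' T (fun ω => V ω k) t v)
    (fun k x y z => ∑ i, (d k (x i) (g k (z i) (y i k)) : ℝ) ≤ n * (D k + ε / 2))
    (fun _ _ => prob_nonneg _ _ _) hq0 hW0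
    (fun _ _ => condProb_nonneg _ _ _ _ _) (fun _ => sum_condProb_le_one _ _ _ _)
    (fun _ _ => condProb_nonneg _ _ _ _ _) (fun _ => sum_condProb_le_one _ _ _ _)
    (fun _ _ _ => condProb_nonneg _ _ _ _ _) (fun _ _ => sum_condProb_le_one _ _ _ _)
    (fun _ _ _ => condProb_nonneg _ _ _ _ _) (fun _ _ => sum_condProb_le_one _ _ _ _)
    (fun _ _ _ => condProb_nonneg _ _ _ _ _) (fun _ _ => sum_condProb_le_one _ _ _ _)
  set good : Fin K → ℝ := fun k => ∑ x : Fin n → 𝒳, ∑ s : Fin m → 𝒮, ∑ y : Fin n → ∀ k, 𝒴 k,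
    ∑ v : Fin m → ∀ k, 𝒱 k, (∏ i, prob P (fun ω => (X ω, Y ω)) (x i, y i)) *
      (Q n m x s).toReal * (∏ j, (W (enc x s j) (s j) (v j)).toReal) *
      truthValue (∑ i, (d k (x i) (g k (dec k (fun j => v j k) (fun i => y i k) i) (y i k)) : ℝ) ≤
        n * (D k + ε / 2)) with hgood
  have htyp := hn₁ m n hm (by omega) hmn
  have hfst : ∀ x, (((P.map fun ω => (X ω, Y ω)).map Prod.fst) x).toReal = prob P X x := fun x => by
    rw [PMF.map_comp]; rfl
  simp only [hfst] at htyp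
  have hlow : ∑ k : Fin K, (1 - δ) ≤ ∑ k, good k := by
    refine le_trans (Finset.sum_le_sum fun k _ => ?_) hcode
    have h1 := le_success_mass_typical hYXZ (fun y => y k) hW0 hW1 hV hTUSV (fun v => v k) hm hmn'
      hq0 (fun x => (hq1 x).le) (fun x y z => (d k x (g k z (y k)) : ℝ)) (D k + ε / 2) η (l k)
      (l' k) (hl0 k).le (hl1 k) (hl'0 k).le
    refine le_trans ?_ h1
    have h2 := hn₂ n (by omega) k
    have h3 := hn₃ n (by omega) k
    linarith
  have hp1 : ∑ x, ∑ y, prob P (fun ω => (X ω, Y ω)) (x, y) = 1 := by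
    rw [← sum_prob P (fun ω => (X ω, Y ω)), Fintype.sum_prod_type]
  have hmass := sum_source_channel_eq_one hp1 hq1 hW1 enc
  have hw0 : ∀ x s (y : Fin n → ∀ k, 𝒴 k) (v : Fin m → ∀ k, 𝒱 k),
      0 ≤ (∏ i, prob P (fun ω => (X ω, Y ω)) (x i, y i)) * (Q n m x s).toReal *
        ∏ j, (W (enc x s j) (s j) (v j)).toReal := fun x s y v =>
    mul_nonneg (mul_nonneg (Finset.prod_nonneg fun _ _ => prob_nonneg _ _ _) (hq0 _ _))
      (Finset.prod_nonneg fun _ _ => hW0 _ _ _)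
  have hgood1 : ∀ k, good k ≤ 1 := by
    intro k
    rw [← hmass]
    refine Finset.sum_le_sum fun x _ => Finset.sum_le_sum fun s _ => Finset.sum_le_sum fun y _ =>
      Finset.sum_le_sum fun v _ => mul_le_of_le_one_right (hw0 x s y v) (truthValue_le_one _)
  -- The code is controlled only through the sum over receivers; as all deficits are nonnegative,
  -- each is at most their total.
  have hbad : ∀ k, 1 - good k ≤ K * δ := by
    intro k
    have h1 : 1 - good k ≤ ∑ k, (1 - good k) :=
      Finset.single_le_sum (f := fun k => 1 - good k) (fun k _ => sub_nonneg.2 (hgood1 k))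
        (Finset.mem_univ k)
    rw [Finset.sum_sub_distrib] at h1
    simp only [Finset.sum_const, Finset.card_univ, Fintype.card_fin, nsmul_eq_mul] at h1 hlow
    linarith
  refine ⟨⟨enc, fun k v y i => g k (dec k v y i) (y i)⟩, fun k => ?_⟩
  -- The distortion is at most `D k + ε / 2` on the good event and at most `M'` elsewhere. Since `D
  -- k + ε / 2 ≥ 0`, the first bound may be charged to the whole mass.
  have hE : expectedDistortion (P.map fun ω => (X ω, Y ω)) W Q
      ⟨enc, fun k v y i => g k (dec k v y i) (y i)⟩ k (d k) ≤
      (D k + ε / 2) * 1 + M' * (1 - good k) := by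
    rw [← hmass]
    simp only [hgood, expectedDistortion, Finset.mul_sum, ← Finset.sum_sub_distrib,
      ← Finset.sum_add_distrib]
    refine Finset.sum_le_sum fun x _ => Finset.sum_comm.trans_le ?_
    refine Finset.sum_le_sum fun s _ => Finset.sum_le_sum fun y _ => Finset.sum_le_sum fun v _ => ?_
    have h0 := hw0 x s y v
    simp only [prob] at h0 ⊢
    have hall : ∑ i, (d k (x i) (g k (dec k (fun j => v j k) (fun i => y i k) i) (y i k)) : ℝ) ≤
        n * M' := by
      refine (Finset.sum_le_sum fun i _ => hM' k _ _ _).trans_eq ?_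
      simp
    by_cases hok : ∑ i, (d k (x i) (g k (dec k (fun j => v j k) (fun i => y i k) i)
        (y i k)) : ℝ) ≤ n * (D k + ε / 2)
    · rw [truthValue_of_true hok]
      have := mul_le_mul_of_nonneg_left (blockDistortion_le hnpos hok) h0
      linarith
    · rw [truthValue_of_not hok]
      have h1 := mul_le_mul_of_nonneg_left (blockDistortion_le hnpos hall) h0
      have h2 := mul_nonneg h0 (by linarith [hD0 k] : 0 ≤ D k + ε / 2)
      linarith
  have hMK : M' * (K * δ) ≤ ε / 2 := by
    rw [hδ]
    have h1 : M' * (K * (ε / (2 * (M' + 1) * (K + 1)))) =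
        ε / 2 * (M' / (M' + 1)) * (K / (K + 1)) := by
      field_simp
    rw [h1]
    have h2 : M' / (M' + 1) ≤ 1 := div_le_one_of_le₀ (by linarith) (by positivity)
    have h3 : (K : ℝ) / (K + 1) ≤ 1 := div_le_one_of_le₀ (by linarith) (by positivity)
    calc _ ≤ ε / 2 * 1 * 1 := by gcongr
      _ = _ := by ring
  have := mul_le_mul_of_nonneg_left (hbad k) hM0
  linarith
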